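/- Let $G=(V,E)$ be a finite simple graph with $n$ vertices and $M$ a matching of $G$. A vertex is free if it is not incident to an edge of $M$; the other vertices $v$ have a mate $\mathrm{mate}(v)$. An alternating path is a simple path whose edges are alternately in $M$ and not in $M$; an augmenting path is an alternating path connecting two distinct free vertices. For a vertex $v$ let $\mathrm{Lcp}(v)$ (respectively $\mathrm{Lcp}_{odd}(v)$) be the length of a shortest even-length (odd-length) alternating path from a free vertex to $v$, and $\infty$ if there is none. **The algorithm (Part I).** It maintains a search structure $S$, a forest of alternating trees, some of whose nodes are contracted sets of vertices (blossoms), a label (unlabeled, even or odd) of every vertex, partially defined values $\mathrm{lcp}(v)$ and $\mathrm{lcp}_{odd}(v)$, and a canonical path $P(v)$ from a free vertex to $v$ for every labeled vertex $v$. $S$ contains the labeled vertices. The phases are numbered $\Delta=0,1,\dots,n+1$. In phase $0$ every free vertex $f$ becomes the root of a tree, is labeled even, and gets $\mathrm{lcp}(f)=0$ and the trivial canonical path; all other vertices are unlabeled. A phase $\Delta\ge 1$ consists of the following steps; the order within each group is arbitrary. *Growth steps (only for even $\Delta$, before the bridge steps).* For all even $v$ with $\mathrm{lcp}(v)=\Delta-2$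 and all edges $vx$: if $x$ is unlabeled, then $x$ becomes an odd child of the node containing $v$ and $y=\mathrm{mate}(x)$ an even child of $x$, $\mathrm{lcp}_{odd}(x):=\Delta-1$, $\mathrm{lcp}(y):=\Delta$, $P(x):=P(v)\,x$ and $P(y):=P(v)\,x\,y$; if $vx\notin M$, $x$ is even with $\mathrm{lcp}(x)=\Delta$ and $\mathrm{lcp}_{odd}(x)$ is undefined, then $\mathrm{lcp}_{odd}(x):=\Delta-1$. *Bridge steps.* As long as there is an edge $xy\notin M$ with $x$, $y$ even, in different nodes of $S$ (that is, in different maximal blossoms), and $\mathrm{lcp}(x)+\mathrm{lcp}(y)=2\Delta-2$, some such edge is added. If $x$ and $y$ are in different trees, the algorithm returns true, having found the path $P(x)\,P(y)^{rev}$. Otherwise let $B$ be the lowest common ancestor of the nodes containing $x$ and $y$. Every odd vertex $z$ on the tree path from the node containing $y$ to $B$ becomes even, with $\mathrm{lcp}(z):=\mathrm{lcp}(x)+1+\mathrm{lcp}(y)-\mathrm{lcp}_{odd}(z)$ and with $P(z):=P(x)$ followed by the edge $xy$ and the reversal of the suffix of $P(y)$ starting in $z$; symmetrically for the path from the node containing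 $x$ to $B$. All nodes on the two paths are contracted into one node, a blossom, whose base is the base of $B$. If no augmenting path is found, phase $\Delta$ is called completed when no eligible bridge is left. After phase $n+1$ has been completed the algorithm returns false. **Lemma (Correctness).** For every execution of the algorithm: 1. For even $\Delta$, at the end of phase $\Delta$ (whether it has been completed or the algorithm has just returned true in it), $S$ contains exactly the vertices that can be reached from a free vertex by an alternating path of length at most $\Delta$. 2. For even $\Delta$, at the end of a completed phase $\Delta$, $\mathrm{lcp}(v)$ is defined if $\mathrm{Lcp}(v)\le\Delta$, and $\mathrm{lcp}_{odd}(v)$ is defined if $\mathrm{Lcp}_{odd}(v)<\mathrm{Lcp}(v)\le\Delta$. 3. For every $\Delta$, any edge $uv$ added in a bridge step of phase $\Delta$ satisfies $\mathrm{Lcp}(u)+\mathrm{Lcp}(v)=2\Delta-2$, $\mathrm{lcp}(u)=\mathrm{Lcp}(u)$ and $\mathrm{lcp}(v)=\mathrm{Lcp}(v)$. 4. For every $\Delta$, when phase $\Delta$ has been completed, any edge $uv$ with $\mathrm{Lcp}(u)+\mathrm{Lcp}(v)=2\Delta-2$ has both endpoints even and in the same maximal blossom (so a non-matching such edge has been added,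 unless its endpoints had come to lie in the same blossom without it). 5. At any point in the execution, $\mathrm{lcp}(v)=\mathrm{Lcp}(v)$ whenever $\mathrm{lcp}(v)$ is defined, and $\mathrm{lcp}_{odd}(v)=\mathrm{Lcp}_{odd}(v)$ whenever $\mathrm{lcp}_{odd}(v)$ is defined. 6. At any point in the execution, the canonical path of an even vertex $v$ is a shortest even-length alternating path from a free vertex to $v$. 7. The algorithm terminates. On termination, either it has returned true in some phase $\Delta$, and the path $P(x)\,P(y)^{rev}$ found is a shortest augmenting path and has length $2\Delta-1$, or it has returned false and there is no augmenting path. -/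

import Mathlib

/-! Part I of the algorithm: search for a shortest augmenting path.

Throughout, `G` is the input graph and `M` the current matching, a subgraph of `G` with
`M.IsMatching`. -/

namespace ShortestAugmentingPath

variable {V : Type*}

/-! ### Alternating paths -/

/-- A vertex is free if no matching edge is incident to it. -/
def IsFree {G : SimpleGraph V} (M : G.Subgraph) (v : V) : Prop :=
  ∀ w, ¬ M.Adj v w

/-- An alternating path: a simple path whose edges alternate between matching and non-matching. -/
def IsAlternatingPath {G : SimpleGraph V} (M : G.Subgraph) {u v : V} (p : G.Walk u v) : Prop :=
  p.IsPath ∧ p.edges.IsChain (fun e e' => e ∈ M.edgeSet ↔ e' ∉ M.edgeSet)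

/-- An augmenting path: an alternating path connecting two distinct free vertices. -/
def IsAugmentingPath {G : SimpleGraph V} (M : G.Subgraph) {u v : V} (p : G.Walk u v) : Prop :=
  IsAlternatingPath M p ∧ IsFree M u ∧ IsFree M v ∧ u ≠ v

/-- `Lcp v`: the length of a shortest even-length alternating path in `G` from a free vertex to
`v`, and `⊤` if there is none. -/
noncomputable def Lcp {G : SimpleGraph V} (M : G.Subgraph) (v : V) : ℕ∞ :=
  sInf {k : ℕ∞ | ∃ (f : V) (p : G.Walk f v), IsFree M f ∧ IsAlternatingPath M p ∧
    Even p.length ∧ k = (p.length : ℕ∞)}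

/-- `LcpOdd v`: the length of a shortest odd-length alternating path in `G` from a free vertex to
`v`, and `⊤` if there is none. -/
noncomputable def LcpOdd {G : SimpleGraph V} (M : G.Subgraph) (v : V) : ℕ∞ :=
  sInf {k : ℕ∞ | ∃ (f : V) (p : G.Walk f v), IsFree M f ∧ IsAlternatingPath M p ∧
    Odd p.length ∧ k = (p.length : ℕ∞)}

/-! ### The state of the algorithm -/

/-- The label of a vertex of `G`. -/
inductive Label where
  | unlabeled
  | even
  | odd

/-- The program position inside the current phase. `found x y`: the bridge `xy` connected two
trees and the algorithm has returned true; `exhausted`: it has returned false. -/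
inductive Stage (V : Type*) where
  | growing
  | bridging
  | found (x y : V)
  | exhausted

/-- The state. The contracted search structures are given by `base` and `parent`: two vertices lie
in the same node of `S` (for even vertices: in the same maximal blossom) iff they have the same
`base`, and a node is represented by the base of its vertices, which is a vertex of the node;
`parent` is the vertex from which a vertex was added to `S` (`none` for free vertices and
unlabeled vertices). `lcp` and `lcpOdd` are the values maintained by the algorithm, `none` meaning
undefined. `canon v` is the list of vertices of the canonical path of `v`, from a free vertex to
`v`. -/
structure State (V : Type*) where
  phase : ℕ
  stage : Stage V
  label : V → Label
  lcp : V → Option ℕ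
  lcpOdd : V → Option ℕ
  parent : V → Option V
  base : V → V
  canon : V → List V

namespace State

/-- `v` belongs to the search structure `S`. -/
def InS (s : State V) (v : V) : Prop :=
  s.label v ≠ Label.unlabeled

/-- The node with representative `c` is the parent, in the contracted search structure, of the
node with representative `a`. -/
def NodeParent (s : State V) (a c : V) : Prop :=
  ∃ p, s.parent a = some p ∧ c = s.base p

/-- The node `c` is an ancestor of the node `a`, or equal to it. -/
def Anc (s : State V) (a c : V) : Prop :=
  Relation.ReflTransGen s.NodeParent a c

/-- The nodes of `x` and `y` belong to the same tree. -/
def SameTree (s : State V) (x y : V) : Prop :=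
  ∃ r, s.Anc (s.base x) r ∧ s.Anc (s.base y) r

/-- `b` is the lowest common ancestor of the nodes containing `x` and `y`. -/
def IsLCA (s : State V) (x y b : V) : Prop :=
  s.Anc (s.base x) b ∧ s.Anc (s.base y) b ∧
    ∀ c, s.Anc (s.base x) c → s.Anc (s.base y) c → s.Anc b c

/-- The node containing `w` lies on the tree path from the node containing `x` to its ancestor
`b` (both ends included). -/
def OnPath (s : State V) (x b w : V) : Prop :=
  s.Anc (s.base x) (s.base w) ∧ s.Anc (s.base w) b

/-- `xy` is an edge eligible for a bridge step of the current phase `Δ`: a non-matching edge with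
two even endpoints in different maximal blossoms and `lcp x + lcp y = 2 Δ - 2`. -/
def IsBridge {G : SimpleGraph V} (M : G.Subgraph) (s : State V) (x y : V) : Prop :=
  G.Adj x y ∧ ¬ M.Adj x y ∧ s.label x = Label.even ∧ s.label y = Label.even ∧
    s.base x ≠ s.base y ∧
    ∃ kx ky, s.lcp x = some kx ∧ s.lcp y = some ky ∧ kx + ky + 2 = 2 * s.phase

open Classical in
/-- The state at the end of the initialization: every free vertex is the root of a tree. -/
noncomputable def init {G : SimpleGraph V} (M : G.Subgraph) : State V where
  phase := 0
  stage := Stage.bridging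
  label := fun v => if IsFree M v then Label.even else Label.unlabeled
  lcp := fun v => if IsFree M v then some 0 else none
  lcpOdd := fun _ => none
  parent := fun _ => none
  base := id
  canon := fun v => if IsFree M v then [v] else []

open Classical in
/-- The growth step out of the even vertex `v` with `lcp v = k` along the edge `vx` to the
unlabeled vertex `x` with mate `y`. -/
noncomputable def grow (s : State V) (v x y : V) (k : ℕ) : State V :=
  { s with
    label := fun w => if w = x then Label.odd else if w = y then Label.even else s.label w
    lcpOdd := fun w => if w = x then some (k + 1) else s.lcpOdd w
    lcp := fun w => if w = y then some (k + 2) else s.lcp w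
    parent := fun w => if w = x then some v else if w = y then some x else s.parent w
    canon := fun w => if w = x then s.canon v ++ [x]
      else if w = y then s.canon v ++ [x, y] else s.canon w }

open Classical in
/-- Sets `lcpOdd x` to `k`. -/
noncomputable def setLcpOdd (s : State V) (x : V) (k : ℕ) : State V :=
  { s with lcpOdd := fun w => if w = x then some k else s.lcpOdd w }

open Classical in
/-- The bridge step for `xy`, where `kx = lcp x`, `ky = lcp y` and `x`, `y` belong to the same
tree; `b` is the lowest common ancestor of their nodes. All nodes on the two tree paths to `b` are
shrunk into one node with base `b`, and every odd vertex `z` on these paths becomes even. For `z`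
on the path from `y`, the canonical path of `z` is the canonical path of `x`, followed by the edge
`xy`, followed by the reversal of the suffix of the canonical path of `y` that starts in `z`;
symmetrically for `z` on the path from `x`. -/
noncomputable def shrink (s : State V) (x y b : V) (kx ky : ℕ) : State V :=
  { s with
    base := fun w => if s.OnPath x b w ∨ s.OnPath y b w then b else s.base w
    label := fun w => if s.OnPath x b w ∨ s.OnPath y b w then Label.even else s.label w
    lcp := fun z => if s.label z = Label.odd ∧ (s.OnPath x b z ∨ s.OnPath y b z) then
        (s.lcpOdd z).map (fun o => kx + 1 + ky - o)
      else s.lcp z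
    canon := fun z =>
      if s.label z = Label.odd ∧ s.OnPath y b z then
        s.canon x ++ ((s.canon y).dropWhile (fun w => decide (w ≠ z))).reverse
      else if s.label z = Label.odd ∧ s.OnPath x b z then
        s.canon y ++ ((s.canon x).dropWhile (fun w => decide (w ≠ z))).reverse
      else s.canon z }

end State

/-! ### The steps of the algorithm -/

/-- A growth step of the current phase `Δ`, out of an even vertex `v` with `lcp v = Δ - 2` along
an edge `vx`. In `extend`, `x` is unlabeled, and `x` and its mate `y` are added to `S`. In
`second`, `x` is an even vertex that was born even in this phase; then only `lcpOdd x` is set, to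
`Δ - 1`. -/
inductive GrowthStep {G : SimpleGraph V} (M : G.Subgraph) : State V → State V → Prop
  | extend (s : State V) (v x y : V) (k : ℕ) :
      s.stage = Stage.growing → s.label v = Label.even → s.lcp v = some k → k + 2 = s.phase →
      G.Adj v x → s.label x = Label.unlabeled → M.Adj x y →
      GrowthStep M s (s.grow v x y k)
  | second (s : State V) (v x : V) (k : ℕ) :
      s.stage = Stage.growing → s.label v = Label.even → s.lcp v = some k → k + 2 = s.phase →
      G.Adj v x → ¬ M.Adj v x → s.label x = Label.even → s.lcp x = some s.phase →
      s.lcpOdd x = none →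
      GrowthStep M s (s.setLcpOdd x (k + 1))

/-- `BridgeStep M s x y t`: a bridge step in state `s` adds the edge `xy` and leads to state `t`.
If the endpoints are in the same tree, a blossom is formed; otherwise the search ends. -/
inductive BridgeStep {G : SimpleGraph V} (M : G.Subgraph) :
    State V → V → V → State V → Prop
  | blossom (s : State V) (x y b : V) (kx ky : ℕ) :
      s.stage = Stage.bridging → s.IsBridge M x y → s.lcp x = some kx → s.lcp y = some ky →
      s.SameTree x y → s.IsLCA x y b →
      BridgeStep M s x y (s.shrink x y b kx ky)
  | augment (s : State V) (x y : V) :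
      s.stage = Stage.bridging → s.IsBridge M x y → ¬ s.SameTree x y →
      BridgeStep M s x y { s with stage := Stage.found x y }

/-- The current phase has been completed without finding an augmenting path: its bridge steps are
in progress and no eligible bridge is left. -/
def PhaseCompleted {G : SimpleGraph V} (M : G.Subgraph) (s : State V) : Prop :=
  s.stage = Stage.bridging ∧ ∀ x y, ¬ s.IsBridge M x y

open Classical in
/-- One step of the algorithm. The order in which the growth steps, and the bridge steps, of a
phase are performed is arbitrary. Growth steps are performed in the even phases, before the bridge
steps; the phases are numbered from `0` to `n + 1`, where `n` is the number of vertices. -/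
inductive Step [Fintype V] {G : SimpleGraph V} (M : G.Subgraph) : State V → State V → Prop
  | growth (s t : State V) : GrowthStep M s t → Step M s t
  | endGrowth (s : State V) : s.stage = Stage.growing → (∀ t, ¬ GrowthStep M s t) →
      Step M s { s with stage := Stage.bridging }
  | bridge (s t : State V) (x y : V) : BridgeStep M s x y t → Step M s t
  | nextPhase (s : State V) : PhaseCompleted M s → s.phase + 1 ≤ Fintype.card V + 1 →
      Step M s { s with
        phase := s.phase + 1
        stage := if Even (s.phase + 1) then Stage.growing else Stage.bridging }
  | giveUp (s : State V) : PhaseCompleted M s → ¬ s.phase + 1 ≤ Fintype.card V + 1 →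
      Step M s { s with stage := Stage.exhausted }

/-- The states that occur in the executions of the algorithm. -/
def Reachable [Fintype V] {G : SimpleGraph V} (M : G.Subgraph) (s : State V) : Prop :=
  Relation.ReflTransGen (Step M) (State.init M) s

/-- The algorithm has terminated. -/
def Terminated [Fintype V] {G : SimpleGraph V} (M : G.Subgraph) (s : State V) : Prop :=
  ∀ t, ¬ Step M s t

end ShortestAugmentingPath

/-! Correctness is proved by linear programming duality. Every value stored by the algorithm is an
upper bound, because a concrete alternating path realizes it. The matching lower bounds come from a
dual solution, which is part of the invariant.

A dual solution (`IsDual`) consists of vertex values `y` and edge values `z` such that `y u + y v +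
z u v` is at least 0 on non-matching edges and equal to 2 on matching edges, while the alternating
sums of `z` along the relevant paths are nonpositive. Suppose that all free vertices have value `1 -
T`. Adding the constraints with alternating signs along a path then shows that an even alternating
path from a free vertex to `v` has length at least `y v + T - 1`, and that an augmenting path has
length at least `2 * T - 1` (`IsDual.le_of_aPath`, `IsDual.le_of_augmenting`).

In phase `Δ` one takes `T = Δ` and lets the labels determine `y` (`DualValues`). For an even vertex
the bound is exactly `lcp v`, and for every other vertex it is at least `Δ`. Growing and shrinking
leave the dual solution unchanged: the value prescribed for a new label equals the old one. Only the
passage to the next phase changes it (`Inv.exists_dual_succ`): even vertices lose 1, odd vertices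
gain 1, and `z` gains 2 on pairs inside a common node. This stays feasible because no growth step is
missing and no eligible bridge is left. The alternating sums stay nonpositive because in each
blossom every vertex except the base is matched inside the blossom (`nonposAltSum_partition`).

Lower bounds for odd paths follow from those for even ones: an odd path to `x` extends to the mate
of `x` (`lcp_mate_le`). The upper bounds rest on the structure of the contracted forest (`TreeInv`),
whose main point is that the canonical path created with a blossom is simple
(`TreeInv.shrink_path`). Termination follows from a bounded progress measure. -/

namespace ShortestAugmentingPath

variable {V : Type*} {G : SimpleGraph V}

/-! ### Alternating paths as lists of vertices -/

/-- Consecutive vertices of the list are adjacent, and the edges alternate between `M` and its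
complement; the first edge is in `M` iff `b` is true. -/
def Alt (M : G.Subgraph) : Bool → List V → Prop
  | b, u :: v :: l => G.Adj u v ∧ (M.Adj u v ↔ b = true) ∧ Alt M (!b) (v :: l)
  | _, [_] => True
  | _, [] => True

/-- `l` is the list of vertices of an alternating path of length `k` from a free vertex to `v`. -/
structure APath (M : G.Subgraph) (l : List V) (k : ℕ) (v : V) : Prop where
  alt : Alt M false l
  nodup : l.Nodup
  free : ∀ f ∈ l.head?, IsFree M f
  last : l.getLast? = some v
  len : l.length = k + 1

variable {M : G.Subgraph}

@[simp] lemma alt_nil (b : Bool) : Alt M b [] := trivial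

@[simp] lemma alt_singleton (b : Bool) (u : V) : Alt M b [u] := trivial

@[simp] lemma alt_cons_cons (b : Bool) (u v : V) (l : List V) :
    Alt M b (u :: v :: l) ↔ G.Adj u v ∧ (M.Adj u v ↔ b = true) ∧ Alt M (!b) (v :: l) := Iff.rfl

lemma alt_append_cons (b : Bool) (l : List V) (a : V) (r : List V) :
    Alt M b (l ++ a :: r) ↔ Alt M b (l ++ [a]) ∧ Alt M (xor b l.length.bodd) (a :: r) := by
  induction l generalizing b with
  | nil => simp
  | cons u l ih =>
    cases l with
    | nil => cases b <;> simp [and_assoc]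
    | cons v l =>
      have := ih (!b)
      simp only [List.cons_append, alt_cons_cons] at this ⊢
      rw [this]
      cases b <;> simp [and_assoc]

/-- The edge that becomes first has index `l.length - 2`, so the parity of `l.length` decides
whether its type differs from that of the old first edge. -/
lemma Alt.reverse {b : Bool} {l : List V} (h : Alt M b l) :
    Alt M (xor b l.length.bodd) l.reverse := by
  induction l generalizing b with
  | nil => simp
  | cons u l ih =>
    cases l with
    | nil => simp
    | cons v l =>
      obtain ⟨h1, h2, h3⟩ := h
      have h4 := ih h3
      rw [List.reverse_cons, List.reverse_cons, List.append_assoc, List.singleton_append,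
        alt_append_cons]
      rw [List.reverse_cons] at h4
      refine ⟨by convert h4 using 1; cases b <;> simp, ?_⟩
      have : M.Adj v u ↔ M.Adj u v := ⟨fun h => h.symm, fun h => h.symm⟩
      simp only [alt_cons_cons, h1.symm, true_and, alt_singleton, and_true, List.length_reverse,
        List.length_cons, Nat.bodd_succ, this, h2]
      cases b <;> cases l.length.bodd <;> simp

lemma Alt.isChain {b : Bool} {l : List V} (h : Alt M b l) : l.IsChain G.Adj := by
  induction l generalizing b with
  | nil => simp
  | cons u l ih =>
    cases l with
    | nil => simp
    | cons v l =>
      obtain ⟨h1, _, h3⟩ := h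
      exact List.isChain_cons_cons.2 ⟨h1, ih h3⟩

lemma Alt.isChain_edges {b : Bool} {u v : V} {p : G.Walk u v} (h : Alt M b p.support) :
    p.edges.IsChain (fun e e' => e ∈ M.edgeSet ↔ e' ∉ M.edgeSet) := by
  induction p generalizing b with
  | nil => simp
  | @cons a c _ h1 p ih =>
    cases p with
    | nil => simp
    | @cons _ d _ h2 p =>
      simp only [SimpleGraph.Walk.support_cons, SimpleGraph.Walk.edges_cons] at h ih ⊢
      have h' := h.2.2
      refine List.isChain_cons_cons.2 ⟨?_, ih h'⟩
      have e1 := h.2.1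
      have e2 : M.Adj c d ↔ (!b) = true := by
        cases p with
        | nil => exact h'.2.1
        | cons h3 p => exact h'.2.1
      simp only [SimpleGraph.Subgraph.mem_edgeSet, e1, e2]
      cases b <;> simp

lemma alt_support {b : Bool} {u v : V} {p : G.Walk u v}
    (h : p.edges.IsChain (fun e e' => e ∈ M.edgeSet ↔ e' ∉ M.edgeSet))
    (hb : ∀ e ∈ p.edges.head?, e ∈ M.edgeSet ↔ b = true) : Alt M b p.support := by
  induction p generalizing b with
  | nil => simp
  | cons h1 p ih =>
    cases p with
    | nil => simpa [h1] using hb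
    | cons h2 p =>
      simp only [SimpleGraph.Walk.support_cons, SimpleGraph.Walk.edges_cons] at h ih ⊢
      obtain ⟨h3, h4⟩ := List.isChain_cons_cons.1 h
      have hb' := hb _ rfl
      change M.Adj _ _ ↔ _ at hb'
      simp only [SimpleGraph.Subgraph.mem_edgeSet] at h3
      refine ⟨h1, hb', ih h4 ?_⟩
      intro e he
      simp only [List.head?_cons, Option.mem_some_iff] at he
      subst he
      rw [hb'] at h3
      cases b <;> simp_all

lemma APath.exists_walk {l : List V} {k : ℕ} {v : V} (h : APath M l k v) :
    ∃ (f : V) (p : G.Walk f v), p.support = l ∧ IsFree M f ∧ IsAlternatingPath M p ∧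
      p.length = k := by
  have hne : l ≠ [] := by rintro rfl; simpa using h.last
  have hv : l.getLast hne = v := by
    have := h.last; rw [List.getLast?_eq_some_getLast hne] at this; simpa using this
  subst hv
  have hs := SimpleGraph.Walk.support_ofSupport hne h.alt.isChain
  refine ⟨_, SimpleGraph.Walk.ofSupport l hne h.alt.isChain, hs, h.free _ ?_, ⟨?_, ?_⟩, ?_⟩
  · rw [List.head?_eq_some_head hne]; rfl
  · rw [SimpleGraph.Walk.isPath_def, hs]; exact h.nodup
  · exact Alt.isChain_edges (b := false) (by rw [hs]; exact h.alt)
  · rw [SimpleGraph.Walk.length_ofSupport, h.len]; rfl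

/-- Starting at a free vertex forces the first edge out of `M`. This fixes the initial parameter of
`Alt` to `false`. -/
lemma IsAlternatingPath.aPath {f v : V} {p : G.Walk f v} (h : IsAlternatingPath M p)
    (hf : IsFree M f) : APath M p.support p.length v where
  alt := by
    refine alt_support h.2 ?_
    cases p with
    | nil => simp
    | cons h1 p => simpa using hf _
  nodup := h.1.support_nodup
  free := by
    cases p with
    | nil => simpa
    | cons h1 p => simpa using hf
  last := by
    rw [List.getLast?_eq_some_getLast p.support_ne_nil, SimpleGraph.Walk.getLast_support]
  len := p.length_support

lemma APath.lcp_le {l : List V} {k : ℕ} {v : V} (h : APath M l k v) (hk : Even k) :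
    Lcp M v ≤ k := by
  obtain ⟨f, p, -, hf, hp, rfl⟩ := h.exists_walk
  exact sInf_le ⟨f, p, hf, hp, hk, rfl⟩

lemma APath.lcpOdd_le {l : List V} {k : ℕ} {v : V} (h : APath M l k v) (hk : Odd k) :
    LcpOdd M v ≤ k := by
  obtain ⟨f, p, -, hf, hp, rfl⟩ := h.exists_walk
  exact sInf_le ⟨f, p, hf, hp, hk, rfl⟩

lemma le_lcp {v : V} {B : ℕ∞} (h : ∀ l k, APath M l k v → Even k → B ≤ k) : B ≤ Lcp M v := by
  refine le_sInf ?_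
  rintro _ ⟨f, p, hf, hp, hk, rfl⟩
  exact h _ _ (hp.aPath hf) hk

lemma exists_aPath_of_lcp_ne_top {v : V} (h : Lcp M v ≠ ⊤) :
    ∃ l k, APath M l k v ∧ Even k ∧ Lcp M v = k := by
  have hne : {k : ℕ∞ | ∃ (f : V) (p : G.Walk f v), IsFree M f ∧ IsAlternatingPath M p ∧
      Even p.length ∧ k = (p.length : ℕ∞)}.Nonempty := by
    by_contra h0
    rw [Set.not_nonempty_iff_eq_empty] at h0
    exact h (by rw [Lcp, h0, sInf_empty])
  obtain ⟨f, p, hf, hp, hk, e⟩ := csInf_mem hne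
  exact ⟨_, _, hp.aPath hf, hk, e⟩

lemma exists_aPath_of_lcpOdd_ne_top {v : V} (h : LcpOdd M v ≠ ⊤) :
    ∃ l k, APath M l k v ∧ Odd k ∧ LcpOdd M v = k := by
  have hne : {k : ℕ∞ | ∃ (f : V) (p : G.Walk f v), IsFree M f ∧ IsAlternatingPath M p ∧
      Odd p.length ∧ k = (p.length : ℕ∞)}.Nonempty := by
    by_contra h0
    rw [Set.not_nonempty_iff_eq_empty] at h0
    exact h (by rw [LcpOdd, h0, sInf_empty])
  obtain ⟨f, p, hf, hp, hk, e⟩ := csInf_mem hne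
  exact ⟨_, _, hp.aPath hf, hk, e⟩

/-! ### Prefixes and extensions of alternating paths -/

lemma bodd_eq_true_iff {n : ℕ} : n.bodd = true ↔ Odd n := by
  rw [← Nat.not_even_iff_odd, Nat.even_iff, Nat.mod_two_of_bodd]
  cases n.bodd <;> simp

lemma bodd_eq_false_iff {n : ℕ} : n.bodd = false ↔ Even n := by
  rw [Nat.even_iff, Nat.mod_two_of_bodd]
  cases n.bodd <;> simp

lemma aPath_singleton {f : V} (hf : IsFree M f) : APath M [f] 0 f where
  alt := trivial
  nodup := by simp
  free := by simpa
  last := rfl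
  len := rfl

lemma APath.take {l r : List V} {a : V} {k : ℕ} {v : V} (h : APath M (l ++ a :: r) k v) :
    APath M (l ++ [a]) l.length a where
  alt := ((alt_append_cons _ _ _ _).1 h.alt).1
  nodup := h.nodup.sublist (by simp)
  free := by
    have := h.free
    cases l <;> simpa using this
  last := by simp
  len := by simp

lemma APath.alt_drop {l r : List V} {a : V} {k : ℕ} {v : V} (h : APath M (l ++ a :: r) k v) :
    Alt M l.length.bodd (a :: r) := by
  simpa using ((alt_append_cons _ _ _ _).1 h.alt).2

lemma APath.exists_eq_append {l : List V} {k : ℕ} {v : V} (h : APath M l k v) :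
    ∃ l', l = l' ++ [v] ∧ l'.length = k := by
  obtain ⟨l', rfl⟩ := List.getLast?_eq_some_iff.1 h.last
  exact ⟨l', rfl, by simpa using h.len⟩

lemma APath.snoc {l : List V} {k : ℕ} {v w : V} (h : APath M l k v) (hw : w ∉ l)
    (ha : G.Adj v w) (hM : M.Adj v w ↔ Odd k) : APath M (l ++ [w]) (k + 1) w := by
  obtain ⟨l', rfl, hl⟩ := h.exists_eq_append
  refine ⟨?_, ?_, ?_, by simp, by simp [hl]⟩
  · rw [List.append_assoc, List.singleton_append, alt_append_cons]
    refine ⟨h.alt, ?_⟩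
    simp [ha, hM, hl, bodd_eq_true_iff]
  · rw [List.nodup_append]
    refine ⟨h.nodup, by simp, ?_⟩
    rintro a ha' b hb rfl
    simp at hb; subst hb; exact hw ha'
  · have := h.free
    cases l' <;> simpa using this

/-- A nontrivial alternating path extends one to the last but one vertex. -/
lemma APath.pred {l : List V} {k : ℕ} {v : V} (h : APath M l (k + 1) v) :
    ∃ l' u, l = l' ++ [v] ∧ APath M l' k u ∧ G.Adj u v ∧ (M.Adj u v ↔ Odd k) ∧ v ∉ l' := by
  obtain ⟨l', rfl, hl⟩ := h.exists_eq_append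
  obtain ⟨l'', u, rfl⟩ : ∃ l'' u, l' = l'' ++ [u] := by
    rcases List.eq_nil_or_concat l' with rfl | ⟨l'', u, rfl⟩
    · simp at hl
    · exact ⟨l'', u, by simp⟩
  have h' := h
  rw [List.append_assoc, List.singleton_append] at h'
  have hk : l''.length = k := by simpa using hl
  have h2 := h'.alt_drop
  refine ⟨_, u, rfl, hk ▸ h'.take, h2.1, ?_, ?_⟩
  · rw [h2.2.1, bodd_eq_true_iff, hk]
  · have := h.nodup
    rw [List.nodup_append] at this
    intro hv
    exact this.2.2 v hv v (by simp) rfl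

/-- A vertex on an even alternating path is reached at an even position, or its successor is its
mate and is reached at an even position. -/
lemma APath.mem_cases {l : List V} {k : ℕ} {v x : V} (h : APath M l k v) (hk : Even k)
    (hx : x ∈ l) :
    (∃ l' j, APath M l' j x ∧ Even j ∧ j ≤ k) ∨
      ∃ l' j m, M.Adj x m ∧ APath M l' j m ∧ Even j ∧ j ≤ k := by
  obtain ⟨l1, l2, rfl⟩ := List.append_of_mem hx
  have hlen := h.len
  simp only [List.length_append, List.length_cons] at hlen
  rcases Nat.even_or_odd l1.length with he | ho
  · exact Or.inl ⟨_, _, h.take, he, by omega⟩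
  · right
    cases l2 with
    | nil =>
      simp at hlen
      rw [hlen] at ho
      exact absurd hk (Nat.not_even_iff_odd.2 ho)
    | cons m l2 =>
      have h2 := h.alt_drop
      have h3 : APath M ((l1 ++ [x]) ++ m :: l2) k v := by simpa using h
      simp only [List.length_cons] at hlen
      refine ⟨_, _, m, h2.2.1.2 (bodd_eq_true_iff.2 ho), h3.take, ?_, ?_⟩
      · simpa using ho.add_one
      · simp; omega

lemma APath.not_isFree {l : List V} {k : ℕ} {v : V} (h : APath M l k v) (hk : Even k)
    (h0 : k ≠ 0) : ¬ IsFree M v := by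
  obtain ⟨k, rfl⟩ := Nat.exists_eq_succ_of_ne_zero h0
  obtain ⟨_, u, -, -, -, h1, -⟩ := h.pred
  intro hf
  exact hf u (h1.2 (by
    rw [Nat.even_add_one, Nat.not_even_iff_odd] at hk
    exact hk)).symm

/-- The mate of a vertex reached by an odd alternating path is reached by an even one that is
longer by one. -/
lemma lcp_mate_le (hM : M.IsMatching) {x m : V} (hxm : M.Adj x m) : Lcp M m ≤ LcpOdd M x + 1 := by
  by_cases htop : LcpOdd M x = ⊤
  · simp [htop]
  obtain ⟨l, k, h, hk, e⟩ := exists_aPath_of_lcpOdd_ne_top htop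
  rw [e]
  -- If `m` were on the path at an even position, it would be the free start or be preceded by its
  -- mate `x`, which would then occur twice. At an odd position its successor is `x`; the path
  -- either ends there, with even length, or visits `x` again.
  suffices hm : m ∉ l by
    have := (h.snoc hm hxm.adj_sub (by simp [hxm, hk])).lcp_le hk.add_one
    simpa using this
  intro hm
  obtain ⟨l1, l2, rfl⟩ := List.append_of_mem hm
  have hne : x ≠ m := hxm.adj_sub.ne
  have hlen := h.len
  have hlast := h.last
  cases l2 with
  | nil => simp at hlast; exact hne hlast.symm
  | cons n l2 =>
    have h2 := h.alt_drop
    simp only [List.length_append, List.length_cons] at hlen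
    rcases Nat.even_or_odd l1.length with he | ho
    · by_cases h0 : l1.length = 0
      · have : l1 = [] := List.length_eq_zero_iff.1 h0
        subst this
        exact h.free m (by simp) x hxm.symm
      · obtain ⟨j, hj⟩ := Nat.exists_eq_succ_of_ne_zero h0
        have h3 := h.take
        rw [hj] at h3
        obtain ⟨l', p, e', hp', -, hp, -⟩ := h3.pred
        have hjo : Odd j := by
          rw [hj, Nat.succ_eq_add_one, Nat.even_add_one, Nat.not_even_iff_odd] at he; exact he
        have hpx : p = x := hM.eq_of_adj_right (hp.2 hjo) hxm
        subst hpx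
        have hmem : p ∈ l1 := by
          have e5 : l1 = l' := by simpa using e'
          rw [e5]
          exact List.mem_of_getLast? hp'.last
        have hx : p ∈ m :: n :: l2 := by
          rw [List.getLast?_append_of_ne_nil _ (by simp)] at hlast
          exact List.mem_of_getLast? hlast
        have := h.nodup
        rw [List.nodup_append] at this
        exact this.2.2 p hmem p hx rfl
    · have h4 := h2.2.1.2 (bodd_eq_true_iff.2 ho)
      have hnx : n = x := hM.eq_of_adj_left h4 hxm.symm
      subst hnx
      cases l2 with
      | nil =>
        simp only [List.length_nil] at hlen
        have : k = l1.length + 1 := by omega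
        rw [this] at hk
        exact absurd hk (Nat.not_odd_iff_even.2 ho.add_one)
      | cons n' l2 =>
        have hx : n ∈ n' :: l2 := by
          have : ((l1 ++ [m, n]) ++ (n' :: l2)).getLast? = some n := by simpa using hlast
          rw [List.getLast?_append_of_ne_nil _ (by simp)] at this
          exact List.mem_of_getLast? this
        have := h.nodup
        simp_all [List.nodup_append]

/-! ### Dual solutions -/

/-- The alternating sum of `g` over the edges of a path. -/
def altSum (g : V → V → ℤ) : List V → ℤ
  | u :: v :: l => g u v - altSum g (v :: l)
  | [_] => 0
  | [] => 0

@[simp] lemma altSum_singleton (g : V → V → ℤ) (u : V) : altSum g [u] = 0 := rfl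

@[simp] lemma altSum_cons_cons (g : V → V → ℤ) (u v : V) (l : List V) :
    altSum g (u :: v :: l) = g u v - altSum g (v :: l) := rfl

lemma altSum_add (g h : V → V → ℤ) (l : List V) :
    altSum (fun u v => g u v + h u v) l = altSum g l + altSum h l := by
  induction l with
  | nil => rfl
  | cons u l ih =>
    cases l with
    | nil => rfl
    | cons v l => simp only [altSum_cons_cons, ih]; ring

lemma altSum_mul (c : ℤ) (g : V → V → ℤ) (l : List V) :
    altSum (fun u v => c * g u v) l = c * altSum g l := by
  induction l with
  | nil => simp [altSum]
  | cons u l ih =>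
    cases l with
    | nil => simp
    | cons v l => simp only [altSum_cons_cons, ih]; ring

lemma altSum_sum {ι : Type*} (s : Finset ι) (g : ι → V → V → ℤ) (l : List V) :
    altSum (fun u v => ∑ i ∈ s, g i u v) l = ∑ i ∈ s, altSum (g i) l := by
  induction l with
  | nil => simp [altSum]
  | cons u l ih =>
    cases l with
    | nil => simp
    | cons v l => simp only [altSum_cons_cons, ih, Finset.sum_sub_distrib]

/-- The alternating sums of `z` over even alternating paths from a free vertex and over augmenting
paths are nonpositive. -/
def NonposAltSum (M : G.Subgraph) (z : V → V → ℤ) : Prop :=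
  ∀ l k v, APath M l k v → (Even k ∨ IsFree M v) → altSum z l ≤ 0

/-- A feasible dual solution, with vertex values `y` and the blossom values collected in `z`, that
is tight on the matching edges. -/
structure IsDual (M : G.Subgraph) (y : V → ℤ) (z : V → V → ℤ) : Prop where
  nonneg : ∀ u v, G.Adj u v → ¬ M.Adj u v → 0 ≤ y u + y v + z u v
  tight : ∀ u v, M.Adj u v → y u + y v + z u v = 2
  nonpos : NonposAltSum M z

variable {y : V → ℤ} {z : V → V → ℤ}

/-- Along a non-matching edge `ax` followed by a matching edge `xc`, subtracting the two constraints
cancels `y x`. The right-hand side 2 of the tight constraint pays for exactly these two edges. -/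
lemma IsDual.sub_le (h : IsDual M y z) {v : V} : ∀ (a : V) (l : List V), Alt M false (a :: l) →
    Even l.length → (a :: l).getLast? = some v → y v - y a ≤ l.length + altSum z (a :: l)
  | a, [], _, _, hv => by simp at hv; simp [hv]
  | a, [_], _, he, _ => by simp at he
  | a, x :: c :: l, ha, he, hv => by
    obtain ⟨h1, h2, h3, h4, h5⟩ := ha
    have ih := IsDual.sub_le h c l h5 (by simpa [Nat.even_add_one] using he) (by simpa using hv)
    have e1 := h.nonneg a x h1 (by simpa using h2)
    have e2 := h.tight x c (by simpa using h4)
    simp only [altSum_cons_cons, List.length_cons]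
    push_cast
    linarith

/-- The same pairing of edges as for even paths. The last non-matching edge is left over and
contributes its constraint, with right-hand side 0. -/
lemma IsDual.neg_add_le (h : IsDual M y z) {v : V} : ∀ (a : V) (l : List V),
    Alt M false (a :: l) → Odd l.length → (a :: l).getLast? = some v →
    -(y a + y v) ≤ l.length - 1 + altSum z (a :: l)
  | a, [], _, he, _ => by simp at he
  | a, [x], ha, _, hv => by
    have e1 := h.nonneg a x ha.1 (by simpa using ha.2.1)
    simp at hv
    subst hv
    simp
    linarith
  | a, x :: c :: l, ha, he, hv => by
    obtain ⟨h1, h2, h3, h4, h5⟩ := ha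
    have ih := IsDual.neg_add_le h c l h5
      (by simpa [Nat.even_add_one, Nat.odd_add_one] using he) (by simpa using hv)
    have e1 := h.nonneg a x h1 (by simpa using h2)
    have e2 := h.tight x c (by simpa using h4)
    simp only [altSum_cons_cons, List.length_cons]
    push_cast
    linarith

lemma APath.exists_cons {l : List V} {k : ℕ} {v : V} (h : APath M l k v) :
    ∃ f l', l = f :: l' ∧ IsFree M f ∧ l'.length = k := by
  cases l with
  | nil => simpa using h.last
  | cons f l => exact ⟨f, l, rfl, h.free f rfl, by simpa using h.len⟩

/-- The dual values bound the lengths of even alternating paths from below. -/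
lemma IsDual.le_of_aPath (h : IsDual M y z) {T : ℤ} (hf : ∀ f, IsFree M f → y f = 1 - T)
    {l : List V} {k : ℕ} {v : V} (hp : APath M l k v) (hk : Even k) : y v + T - 1 ≤ k := by
  have h0 := h.nonpos _ _ _ hp (Or.inl hk)
  obtain ⟨f, l', rfl, hfree, rfl⟩ := hp.exists_cons
  have h1 := h.sub_le f l' hp.alt hk hp.last
  rw [hf f hfree] at h1
  linarith

/-- The dual values bound the lengths of augmenting paths from below. -/
lemma IsDual.le_of_augmenting (h : IsDual M y z) {T : ℤ} (hf : ∀ f, IsFree M f → y f = 1 - T)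
    {l : List V} {k : ℕ} {v : V} (hp : APath M l k v) (hk : Odd k) (hv : IsFree M v) :
    2 * T - 1 ≤ k := by
  have h0 := h.nonpos _ _ _ hp (Or.inr hv)
  obtain ⟨f, l', rfl, hfree, rfl⟩ := hp.exists_cons
  have h1 := h.neg_add_le f l' hp.alt hk hp.last
  rw [hf f hfree, hf v hv] at h1
  linarith

/-! ### Partitions into blossoms -/

section Partition

open Classical in
/-- The indicator function of the class with representative `b`. -/
noncomputable def classInd (base : V → V) (b u : V) : ℤ := if base u = b then 1 else 0

lemma classInd_mul_le (base : V → V) (b u v : V) :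
    2 * (classInd base b u * classInd base b v) ≤ classInd base b u + classInd base b v := by
  unfold classInd
  split_ifs <;> norm_num

lemma classInd_nonneg (base : V → V) (b u : V) : 0 ≤ classInd base b u := by
  unfold classInd
  split_ifs <;> norm_num

open Classical in
-- A non-matching edge inside the class is charged half to each endpoint. A matching edge subtracts
-- both charges if it lies inside the class. It can leave the class only at the representative `b`,
-- since every other member is matched inside. Hence only the start and the occurrences of `b`
-- remain.
lemma altSum_class_le {base : V → V}
    (hbase : ∀ v, base v ≠ v → ∃ w, M.Adj v w ∧ base w = base v) (hM : M.IsMatching) (b : V)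
    {v : V} : ∀ (a : V) (l : List V), Alt M false (a :: l) →
    (a :: l).getLast? = some v → (Even l.length ∨ IsFree M v) →
    2 * altSum (fun u v => classInd base b u * classInd base b v) (a :: l) ≤
      classInd base b a + l.count b
  | a, [], _, _, _ => by simpa using classInd_nonneg base b a
  | a, [x], _, hv, hf => by
    simp at hv
    subst hv
    have hx : base x = x := by
      by_contra hx
      obtain ⟨w, hw, -⟩ := hbase x hx
      exact (by simpa using hf : IsFree M x) w hw
    have h1 := classInd_mul_le base b a x
    have h2 : classInd base b x = [x].count b := by simp [classInd, hx, List.count_singleton]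
    rw [← h2]
    simpa using h1
  | a, x :: c :: l, ha, hv, hf => by
    obtain ⟨h1, h2, h3, h4, h5⟩ := ha
    have ih := altSum_class_le hbase hM b c l h5 (by simpa using hv)
      (by simpa [Nat.even_add_one] using hf)
    have hxc : M.Adj x c := by simpa using h4
    have e1 := classInd_mul_le base b a x
    have e2 : classInd base b x + classInd base b c
        - 2 * (classInd base b x * classInd base b c)
        ≤ (if x = b then 1 else 0) + (if c = b then 1 else 0) := by
      have hx : base x = b → base c ≠ b → x = b := by
        intro hb hc
        by_contra hne
        obtain ⟨w, hw, hw'⟩ := hbase x (by rw [hb]; exact Ne.symm hne)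
        rw [hM.eq_of_adj_left hw hxc] at hw'
        exact hc (hw'.trans hb)
      have hc : base c = b → base x ≠ b → c = b := by
        intro hb hc
        by_contra hne
        obtain ⟨w, hw, hw'⟩ := hbase c (by rw [hb]; exact Ne.symm hne)
        rw [hM.eq_of_adj_left hw hxc.symm] at hw'
        exact hc (hw'.trans hb)
      unfold classInd
      split_ifs <;> simp_all
    have e3 : ((x :: c :: l).count b : ℤ)
        = l.count b + ((if x = b then 1 else 0) + (if c = b then 1 else 0)) := by
      simp only [List.count_cons, beq_iff_eq]
      push_cast
      ring
    rw [e3]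
    simp only [altSum_cons_cons]
    linarith

open Classical in
/-- The alternating sums of the indicator function of the edges within a class are nonpositive. -/
lemma nonposAltSum_partition [Fintype V] {base : V → V}
    (hbase : ∀ v, base v ≠ v → ∃ w, M.Adj v w ∧ base w = base v) (hM : M.IsMatching) :
    NonposAltSum M (fun u v => if base u = base v then 1 else 0) := by
  intro l k v hp hk
  have e : (fun u v : V => if base u = base v then (1 : ℤ) else 0) =
      fun u v => ∑ b : V, classInd base b u * classInd base b v := by
    funext u v
    simp [classInd]
  rw [e, altSum_sum]
  refine Finset.sum_nonpos fun b _ => ?_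
  have hnd := hp.nodup
  obtain ⟨f, l', rfl, hfree, rfl⟩ := hp.exists_cons
  have h1 := altSum_class_le hbase hM b f l' hp.alt hp.last hk
  have h2 : classInd base b f ≤ if f = b then 1 else 0 := by
    have hx : base f = f := by
      by_contra hx
      obtain ⟨w, hw, -⟩ := hbase f hx
      exact hfree w hw
    simp [classInd, hx]
  have h3 : ((f :: l').count b : ℤ) ≤ 1 := by
    exact_mod_cast List.nodup_iff_count_le_one.1 hnd b
  simp only [List.count_cons, beq_iff_eq] at h3
  push_cast at h3
  -- A simple path meets `b` at most once, so twice the integer sum is at most 1.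
  linarith

end Partition

/-- Closure under sums and nonnegative multiples lets `z` accumulate the contributions of all phases
without recording how the blossoms are nested. -/
lemma NonposAltSum.add {z z' : V → V → ℤ} (h : NonposAltSum M z) (h' : NonposAltSum M z') :
    NonposAltSum M (fun u v => z u v + z' u v) := by
  intro l k v hp hk
  rw [altSum_add]
  linarith [h l k v hp hk, h' l k v hp hk]

lemma NonposAltSum.mul {z : V → V → ℤ} (h : NonposAltSum M z) {c : ℤ} (hc : 0 ≤ c) :
    NonposAltSum M (fun u v => c * z u v) := by
  intro l k v hp hk
  rw [altSum_mul]
  exact mul_nonpos_of_nonneg_of_nonpos hc (h l k v hp hk)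

/-! ### The invariant -/

/-- The value of the dual variables at the state `s`, in terms of the labels. -/
def DualValues (s : State V) (y : V → ℤ) : Prop :=
  (∀ v, s.label v = Label.unlabeled → y v = 1) ∧
  (∀ v k, s.label v = Label.even → s.lcp v = some k → y v = k - s.phase + 1) ∧
  (∀ v k, s.label v = Label.odd → s.lcpOdd v = some k → y v = s.phase - k)

/-- The part of the invariant that describes the search structure. -/
structure TreeInv (M : G.Subgraph) (s : State V) : Prop where
  free : ∀ v, IsFree M v → s.label v = Label.even ∧ s.lcp v = some 0 ∧ s.canon v = [v] ∧
    s.parent v = none ∧ s.base v = v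
  unlabeled : ∀ v, s.label v = Label.unlabeled → s.parent v = none ∧ s.base v = v
  base_base : ∀ v, s.base (s.base v) = s.base v
  -- Applied to all vertices of a node, this makes the base the only vertex not matched inside the
  -- node, as the partition argument requires.
  base_mate : ∀ v, s.base v ≠ v → s.label v = Label.even ∧ s.label (s.base v) = Label.even ∧
    ∃ w, M.Adj v w ∧ s.base w = s.base v
  mate_unlabeled : ∀ v w, M.Adj v w → s.label v = Label.unlabeled → s.label w = Label.unlabeled
  mate_odd : ∀ v w, M.Adj v w → s.label v = Label.odd → s.label w = Label.even
  mate_even : ∀ v w, M.Adj v w → s.label v = Label.even → s.label w = Label.even →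
    s.base v = s.base w
  odd : ∀ v, s.label v = Label.odd → ∃ o p, s.lcpOdd v = some o ∧ Odd o ∧ o + 1 ≤ s.phase ∧
    APath M (s.canon v) o v ∧ s.parent v = some p
  even : ∀ v, s.label v = Label.even → ∃ k, s.lcp v = some k ∧ Even k ∧ APath M (s.canon v) k v
  lcp_label : ∀ v k, s.lcp v = some k → s.label v = Label.even
  canon_base : ∀ v, s.InS v → ∃ q, s.canon v = s.canon (s.base v) ++ q ∧
    ∀ w ∈ q, s.base w = s.base v
  parent_canon : ∀ a p, s.base a = a → s.parent a = some p → s.canon a = s.canon p ++ [a]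
  parent_inS : ∀ a p, s.parent a = some p → s.InS a ∧ s.InS p
  parent_odd : ∀ a p, s.parent a = some p → s.label p = Label.odd → M.Adj p a
  rep_parent : ∀ b, s.base b = b → s.label b = Label.even → ¬ IsFree M b →
    ∃ p, s.parent b = some p ∧ s.label p = Label.odd

/-- The invariant of the algorithm. -/
structure Inv (M : G.Subgraph) (s : State V) : Prop extends TreeInv M s where
  lcpOdd_eq : ∀ v k, s.lcpOdd v = some k → LcpOdd M v = k
  reach : ∀ v, s.InS v → ∃ l k, APath M l k v ∧ k ≤ s.phase
  -- This concerns even vertices without an odd value. The bound on the mate yields the lower bound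
  -- for `LcpOdd` when that value is set later.
  bornEven : ∀ v k, s.lcp v = some k → s.lcpOdd v = none →
    k ≤ s.phase ∧ ∀ m, M.Adj v m → k ≤ Lcp M m
  -- The effect of the growth steps already exhausted: those out of vertices with `k + 2 < Δ`, and
  -- also those with `k + 2 = Δ` once growing has ended. The last clause says that no odd value has
  -- been missed.
  complete : ∀ u v k, s.lcp u = some k → G.Adj u v →
    k + 2 < s.phase ∨ (k + 2 ≤ s.phase ∧ s.stage ≠ Stage.growing) →
    s.InS v ∧ ∀ l, s.lcp v = some l → s.lcpOdd v = none → ¬ M.Adj u v → l ≤ k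
  dual : ∃ y z, IsDual M y z ∧ DualValues s y ∧ ∀ u v, s.base u ≠ s.base v → z u v = 0
  found : ∀ x y, s.stage = Stage.found x y → s.IsBridge M x y ∧ ¬ s.SameTree x y

/-! ### Ancestors and canonical paths in the contracted forest. -/

namespace TreeInv

variable {s : State V}

lemma inS_of_even {v : V} (h : s.label v = Label.even) : s.InS v := by simp [State.InS, h]

lemma inS_of_odd {v : V} (h : s.label v = Label.odd) : s.InS v := by simp [State.InS, h]

lemma label_base (h : TreeInv M s) {v : V} (hv : s.label v = Label.even) :
    s.label (s.base v) = Label.even := by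
  by_cases hb : s.base v = v
  · rw [hb, hv]
  · exact (h.base_mate v hb).2.1

lemma base_of_not_even (h : TreeInv M s) {v : V} (hv : s.label v ≠ Label.even) :
    s.base v = v := by
  by_contra hb
  exact hv (h.base_mate v hb).1

lemma base_of_odd (h : TreeInv M s) {v : V} (hv : s.label v = Label.odd) : s.base v = v :=
  h.base_of_not_even (by simp [hv])

lemma inS_base_iff (h : TreeInv M s) (v : V) : s.InS (s.base v) ↔ s.InS v := by
  by_cases hb : s.base v = v
  · rw [hb]
  · have := h.base_mate v hb
    simp [State.InS, this.1, this.2.1]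

lemma nodup_canon (h : TreeInv M s) {v : V} (hv : s.InS v) : (s.canon v).Nodup := by
  cases hl : s.label v with
  | unlabeled => exact absurd hl hv
  | even => obtain ⟨_, _, _, h1⟩ := h.even v hl; exact h1.nodup
  | odd => obtain ⟨_, _, _, _, _, h1, _⟩ := h.odd v hl; exact h1.nodup

/-- The parent node is represented by its base. -/
lemma nodeParent_inS (h : TreeInv M s) {a c : V} (ha : s.NodeParent a c) :
    s.InS a ∧ s.InS c ∧ s.base c = c := by
  obtain ⟨p, hp, rfl⟩ := ha
  have := h.parent_inS a p hp
  exact ⟨this.1, (h.inS_base_iff p).2 this.2, h.base_base p⟩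

lemma anc_rep (h : TreeInv M s) {a c : V} (hac : s.Anc a c) (ha : s.InS a) (hb : s.base a = a) :
    s.InS c ∧ s.base c = c := by
  induction hac with
  | refl => exact ⟨ha, hb⟩
  | tail _ h1 _ => exact (h.nodeParent_inS h1).2

lemma anc_base_rep (h : TreeInv M s) {x c : V} (hac : s.Anc (s.base x) c) (hx : s.InS x) :
    s.InS c ∧ s.base c = c :=
  h.anc_rep hac ((h.inS_base_iff x).2 hx) (h.base_base x)

/-- The canonical path of a vertex extends the ones of the bases of the ancestor nodes, within the
nodes in between. -/
lemma canon_eq_append_of_anc (h : TreeInv M s) {a c : V} (hac : s.Anc a c) :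
    ∀ v, s.InS v → s.base v = a → ∃ r, s.canon v = s.canon c ++ r ∧
      ∀ w ∈ r, s.Anc a (s.base w) ∧ s.Anc (s.base w) c := by
  induction hac using Relation.ReflTransGen.head_induction_on with
  | refl =>
    intro v hv hva
    obtain ⟨q, hq, hq'⟩ := h.canon_base v hv
    refine ⟨q, by rw [hq, hva], fun w hw => ?_⟩
    rw [hq' w hw, hva]
    exact ⟨.refl, .refl⟩
  | @head a a' h1 h2 ih =>
    intro v hv hva
    obtain ⟨q, hq, hq'⟩ := h.canon_base v hv
    have hac : s.Anc a c := .head h1 h2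
    obtain ⟨p, hp, rfl⟩ := id h1
    obtain ⟨r, hr, hr'⟩ := ih p (h.parent_inS a p hp).2 rfl
    have hba : s.base a = a := by rw [← hva]; exact h.base_base v
    refine ⟨r ++ [a] ++ q, ?_, ?_⟩
    · rw [hq, hva, h.parent_canon a p hba hp, hr]; simp
    · intro w hw
      simp only [List.mem_append, List.mem_singleton] at hw
      rcases hw with (hw | rfl) | hw
      · exact ⟨.head h1 (hr' w hw).1, (hr' w hw).2⟩
      · rw [hba]; exact ⟨.refl, hac⟩
      · rw [hq' w hw, hva]; exact ⟨.refl, hac⟩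

lemma length_canon_le (h : TreeInv M s) {a c : V} (hac : s.Anc a c) (ha : s.InS a)
    (hb : s.base a = a) : (s.canon c).length ≤ (s.canon a).length := by
  obtain ⟨r, hr, -⟩ := h.canon_eq_append_of_anc hac a ha hb
  simp [hr]

/-- The length of the canonical path of a representative serves as its depth: it drops strictly at
each step to the parent node. Antisymmetry of the ancestor relation and the existence of lowest
common ancestors rest on this. -/
lemma length_canon_lt (h : TreeInv M s) {a c : V} (hac : s.NodeParent a c)
    (hb : s.base a = a) : (s.canon c).length < (s.canon a).length := by
  obtain ⟨p, hp, rfl⟩ := hac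
  obtain ⟨q, hq, -⟩ := h.canon_base p (h.parent_inS a p hp).2
  simp [h.parent_canon a p hb hp, hq]

lemma anc_antisymm (h : TreeInv M s) {a c : V} (hac : s.Anc a c) (hca : s.Anc c a)
    (hb : s.base a = a) : a = c := by
  rcases Relation.ReflTransGen.cases_head hac with rfl | ⟨d, hd, hdc⟩
  · rfl
  · have h1 := h.length_canon_lt hd hb
    have h2 := h.nodeParent_inS hd
    have h3 := h.length_canon_le (hdc.trans hca) h2.2.1 h2.2.2
    omega

/-- Every vertex of the canonical path of `v` lies in an ancestor of the node of `v`. -/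
lemma anc_of_mem_canon (h : TreeInv M s) {w : V} : ∀ {v : V}, s.InS v → w ∈ s.canon v →
    s.Anc (s.base v) (s.base w) := by
  suffices H : ∀ n v, (s.canon v).length ≤ n → s.InS v → w ∈ s.canon v →
      s.Anc (s.base v) (s.base w) by
    intro v hv hw
    exact H _ v le_rfl hv hw
  intro n
  induction n with
  | zero =>
    intro v hn _ hw
    rw [List.length_eq_zero_iff.1 (Nat.le_zero.1 hn)] at hw
    simp at hw
  | succ n ih =>
    intro v hn hv hw
    obtain ⟨q, hq, hq'⟩ := h.canon_base v hv
    rw [hq, List.mem_append] at hw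
    rcases hw with hw | hw
    swap
    · rw [hq' w hw]; exact .refl
    have hroot : ∀ p, s.parent (s.base v) = some p → s.Anc (s.base v) (s.base w) := by
      intro p hp
      have hc := h.parent_canon _ _ (h.base_base v) hp
      rw [hc, List.mem_append, List.mem_singleton] at hw
      rcases hw with hw | rfl
      · refine .head ⟨p, hp, rfl⟩ (ih p ?_ (h.parent_inS _ _ hp).2 hw)
        rw [hq, hc] at hn
        simp at hn
        omega
      · rw [h.base_base]; exact .refl
    cases hl : s.label (s.base v) with
    | unlabeled => exact absurd hl ((h.inS_base_iff v).2 hv)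
    | odd => obtain ⟨_, p, _, _, _, _, hp⟩ := h.odd _ hl; exact hroot p hp
    | even =>
      by_cases hf : IsFree M (s.base v)
      · rw [(h.free _ hf).2.2.1, List.mem_singleton] at hw
        rw [hw, h.base_base]; exact .refl
      · obtain ⟨p, hp, _⟩ := h.rep_parent _ (h.base_base v) hl hf
        exact hroot p hp

lemma inS_of_mem_canon (h : TreeInv M s) {v w : V} (hv : s.InS v) (hw : w ∈ s.canon v) :
    s.InS w :=
  (h.inS_base_iff w).1 (h.anc_base_rep (h.anc_of_mem_canon hv hw) hv).1

lemma anc_total (_ : TreeInv M s) {a c d : V} (hc : s.Anc a c) (hd : s.Anc a d) :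
    s.Anc c d ∨ s.Anc d c := by
  refine Relation.ReflTransGen.total_of_right_unique ?_ hc hd
  rintro a b c ⟨p, hp, rfl⟩ ⟨q, hq, rfl⟩
  rw [hp] at hq
  simp at hq
  rw [hq]

/-- The lowest common ancestor of two nodes of a tree exists. -/
lemma exists_isLCA (h : TreeInv M s) {x y : V} (hx : s.InS x) (hxy : s.SameTree x y) :
    ∃ b, s.IsLCA x y b := by
  classical
  obtain ⟨r, hr⟩ := hxy
  have hbound : ∀ c, s.Anc (s.base x) c ∧ s.Anc (s.base y) c →
      (s.canon c).length ≤ (s.canon (s.base x)).length := fun c hc =>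
    h.length_canon_le hc.1 ((h.inS_base_iff x).2 hx) (h.base_base x)
  let P : ℕ → Prop := fun n => ∃ c, (s.Anc (s.base x) c ∧ s.Anc (s.base y) c) ∧
    (s.canon c).length = n
  have hP : P (s.canon r).length := ⟨r, hr, rfl⟩
  -- Ancestors of a node form a chain, so a common ancestor with the longest canonical path is the
  -- lowest one.
  obtain ⟨b, hb, hbl⟩ := Nat.findGreatest_spec (P := P) (hbound r hr) hP
  refine ⟨b, hb.1, hb.2, fun c hcx hcy => ?_⟩
  rcases h.anc_total hb.1 hcx with h1 | h1
  · exact h1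
  · have h2 : (s.canon c).length ≤ (s.canon b).length := by
      rw [hbl]
      exact Nat.le_findGreatest (hbound c ⟨hcx, hcy⟩) ⟨c, ⟨hcx, hcy⟩, rfl⟩
    rcases Relation.ReflTransGen.cases_head h1 with rfl | ⟨d, hd, hdc⟩
    · exact .refl
    · have h3 := h.length_canon_lt hd (h.anc_base_rep hcx hx).2
      have h4 := h.nodeParent_inS hd
      have h5 := h.length_canon_le hdc h4.2.1 h4.2.2
      omega

/-- The node below an odd node on the path from a different node is its mate. -/
lemma exists_child_of_odd (h : TreeInv M s) {a o : V} (hao : s.Anc a o) (hne : a ≠ o)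
    (ho : s.label o = Label.odd) : ∃ c, s.Anc a c ∧ s.parent c = some o ∧ M.Adj o c := by
  rcases Relation.ReflTransGen.cases_tail hao with rfl | ⟨c, hc, p, hp, hpo⟩
  · exact absurd rfl hne
  · have : p = o := by
      by_contra hpne
      have := (h.base_mate p (by rw [← hpo]; exact Ne.symm hpne)).2.1
      rw [← hpo, ho] at this
      cases this
    subst this
    exact ⟨c, hc, hp, h.parent_odd c p hp ho⟩

/-- An odd node has only one child, its mate. Both tree paths would pass through that child, which
would then be a lower common ancestor. -/
lemma label_lca (h : TreeInv M s) (hM : M.IsMatching) {x y b : V} (hx : s.label x = Label.even)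
    (hy : s.label y = Label.even) (hb : s.IsLCA x y b) : s.label b = Label.even := by
  have hbr := h.anc_base_rep hb.1 (inS_of_even hx)
  cases hl : s.label b with
  | unlabeled => exact absurd hl hbr.1
  | even => rfl
  | odd =>
    exfalso
    have hne : ∀ v, s.label v = Label.even → s.base v ≠ b := by
      rintro v hv rfl
      rw [h.label_base hv] at hl
      cases hl
    obtain ⟨c, hc, hpc, hMc⟩ := h.exists_child_of_odd hb.1 (hne x hx) hl
    obtain ⟨d, hd, -, hMd⟩ := h.exists_child_of_odd hb.2.1 (hne y hy) hl
    obtain rfl : c = d := hM.eq_of_adj_left hMc hMd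
    have h1 := hb.2.2 c hc hd
    have h2 : s.NodeParent c b := ⟨b, hpc, hbr.2.symm⟩
    have h3 := h.length_canon_lt h2 (h.anc_base_rep hc (inS_of_even hx)).2
    have h4 := h.length_canon_le h1 hbr.1 hbr.2
    omega

/-- The mate of an odd vertex of a path of the search structure that starts in an even node is its
predecessor on the path. -/
lemma onPath_mate (h : TreeInv M s) (hM : M.IsMatching) {x b o m : V}
    (hx : s.label x = Label.even) (ho : s.label o = Label.odd) (hp : s.OnPath x b o)
    (hm : M.Adj o m) : s.OnPath x b m ∧ s.base m = m ∧ s.parent m = some o := by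
  have hbo := h.base_of_odd ho
  obtain ⟨h1, h2⟩ := hp
  rw [hbo] at h1 h2
  obtain ⟨c, hc, hpc, hMc⟩ := h.exists_child_of_odd h1 (by
    rintro rfl
    rw [h.label_base hx] at ho
    cases ho) ho
  obtain rfl : c = m := hM.eq_of_adj_left hMc hm
  have hcb := (h.anc_base_rep hc (inS_of_even hx)).2
  exact ⟨⟨by rwa [hcb], by rw [hcb]; exact .head ⟨o, hpc, hbo.symm⟩ h2⟩, hcb, hpc⟩

end TreeInv

/-- An even alternating path is joined by a non-matching edge to a disjoint alternating path that
starts with a matching edge. -/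
lemma APath.join {l r : List V} {k : ℕ} {x y v : V} (h : APath M l k x) (hk : Even k)
    (hr : Alt M true (y :: r)) (hnd : (y :: r).Nodup) (hxy : G.Adj x y) (hM : ¬ M.Adj x y)
    (hdis : ∀ w ∈ l, w ∉ y :: r) (hv : (y :: r).getLast? = some v) :
    APath M (l ++ y :: r) (k + 1 + r.length) v := by
  obtain ⟨l', rfl, rfl⟩ := h.exists_eq_append
  refine ⟨?_, ?_, ?_, ?_, ?_⟩
  · rw [alt_append_cons, List.append_assoc, List.singleton_append, alt_append_cons]
    refine ⟨⟨h.alt, ?_⟩, ?_⟩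
    · simp [hxy, hM, bodd_eq_false_iff.2 hk]
    · simpa [bodd_eq_false_iff.2 hk] using hr
  · rw [List.nodup_append]
    refine ⟨h.nodup, hnd, ?_⟩
    rintro a ha b hb rfl
    exact hdis a ha hb
  · have := h.free
    cases l' <;> simpa using this
  · rw [List.getLast?_append_of_ne_nil _ (by simp), hv]
  · simp; omega

/-! ### Contraction of a blossom and the new canonical paths. -/

namespace TreeInv

variable {s : State V}

open Classical in
/-- The canonical path given to an odd vertex when a blossom is formed. -/
lemma shrink_path (h : TreeInv M s) (hM : M.IsMatching) {x y b z : V} {kx ky o : ℕ}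
    (hadj : G.Adj x y) (hxy : ¬ M.Adj x y) (hx : s.label x = Label.even)
    (hy : s.label y = Label.even) (hkx : s.lcp x = some kx) (hky : s.lcp y = some ky)
    (hb : s.IsLCA x y b) (hz : s.label z = Label.odd) (ho : s.lcpOdd z = some o)
    (hzp : s.OnPath y b z) {l : List V}
    (hl : l = s.canon x ++ ((s.canon y).dropWhile (fun w => decide (w ≠ z))).reverse) :
    APath M l (kx + 1 + ky - o) z ∧ Odd o ∧ o < ky ∧
      ∃ q, l = s.canon b ++ q ∧ ∀ w ∈ q, s.OnPath x b w ∨ s.OnPath y b w := by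
  obtain ⟨kx', e1, hkxe, hpx⟩ := h.even x hx
  obtain rfl : kx = kx' := by rw [hkx] at e1; simpa using e1
  obtain ⟨ky', e2, hkye, hpy⟩ := h.even y hy
  obtain rfl : ky = ky' := by rw [hky] at e2; simpa using e2
  obtain ⟨o', _, e3, hoo, _, hpz, _⟩ := h.odd z hz
  obtain rfl : o = o' := by rw [ho] at e3; simpa using e3
  have hbz := h.base_of_odd hz
  obtain ⟨hyz, hzb⟩ := hzp
  rw [hbz] at hyz hzb
  obtain ⟨r, hr, hr'⟩ := h.canon_eq_append_of_anc hyz y (inS_of_even hy) rfl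
  obtain ⟨p, hp, rfl⟩ := hpz.exists_eq_append
  have hcy : s.canon y = p ++ z :: r := by rw [hr, hp]; simp
  have hnd := h.nodup_canon (inS_of_even hy)
  rw [hcy] at hnd hpy
  have hdrop : (s.canon y).dropWhile (fun w => decide (w ≠ z)) = z :: r := by
    rw [hcy, List.dropWhile_append_of_pos]
    · simp
    · intro w hw
      have : w ≠ z := by
        rintro rfl
        rw [List.nodup_append] at hnd
        exact hnd.2.2 w hw w (by simp) rfl
      simpa using this
  rw [hdrop] at hl
  have halt := hpy.alt_drop
  rw [bodd_eq_true_iff.2 hoo] at halt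
  have hlen := hpy.len
  simp only [List.length_append, List.length_cons] at hlen
  -- The suffix of the canonical path of `y` from `z` has `ky - o` edges, with `ky` even and `o`
  -- odd. So its reversal starts, like the suffix itself, with a matching edge.
  have hro : Odd r.length := by
    rcases Nat.even_or_odd r.length with he | he
    · exact absurd hkye (Nat.not_even_iff_odd.2 (by
        rw [show ky = p.length + r.length by omega]; exact hoo.add_even he))
    · exact he
  have halt' := halt.reverse
  rw [List.length_cons, bodd_eq_false_iff.2 hro.add_one] at halt'
  obtain ⟨r', hr''⟩ : ∃ r', (z :: r).reverse = y :: r' := by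
    have hlast := hpy.last
    rw [List.getLast?_append_of_ne_nil _ (by simp), List.getLast?_eq_some_iff] at hlast
    obtain ⟨t, ht⟩ := hlast
    exact ⟨t.reverse, by rw [ht]; simp⟩
  have hon : ∀ w ∈ z :: r, s.Anc (s.base y) (s.base w) ∧ s.Anc (s.base w) z := by
    intro w hw
    rcases List.mem_cons.1 hw with rfl | hw
    · rw [hbz]; exact ⟨hyz, .refl⟩
    · exact hr' w hw
  have hrl : r'.length = r.length := by
    have := congrArg List.length hr''
    simpa using this.symm
  have hpath := hpx.join (r := r') (v := z) hkxe (by rw [← hr'']; simpa using halt')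
    (by rw [← hr'', List.nodup_reverse]; exact (List.nodup_append.1 hnd).2.1) hadj hxy
    (by
      -- The node of a common vertex would be an ancestor of both `x` and `y`, hence of `b`, and
      -- also lie at or below `z`. Then `z = b`, which is impossible because `b` is even.
      intro w hw hw'
      rw [← hr'', List.mem_reverse] at hw'
      have h1 := h.anc_of_mem_canon (inS_of_even hx) hw
      have h2 := hon w hw'
      have h3 := (hb.2.2 _ h1 h2.1).trans h2.2
      have h4 := h.anc_antisymm hzb h3 hbz
      rw [h4, h.label_lca hM hx hy hb] at hz
      cases hz)
    (by rw [← hr'']; simp)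
  rw [← hr'', ← hl, hrl] at hpath
  obtain ⟨rx, hrx, hrx'⟩ := h.canon_eq_append_of_anc hb.1 x (inS_of_even hx) rfl
  refine ⟨?_, hoo, by have := hro.pos; omega, rx ++ (z :: r).reverse, ?_, ?_⟩
  · convert hpath using 1
    omega
  · rw [hl, hrx]; simp
  · intro w hw
    rw [List.mem_append, List.mem_reverse] at hw
    rcases hw with hw | hw
    · exact Or.inl (hrx' w hw)
    · exact Or.inr ⟨(hon w hw).1, (hon w hw).2.trans hzb⟩

/-- The nodes that are contracted when a blossom is formed. -/
abbrev Shrunk (s : State V) (x y b w : V) : Prop := s.OnPath x b w ∨ s.OnPath y b w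

lemma shrunk_congr {x y b w w' : V} (h : s.base w = s.base w') :
    Shrunk s x y b w ↔ Shrunk s x y b w' := by
  simp [Shrunk, State.OnPath, h]

section Shrunk

variable {x y b : V}

lemma Shrunk.inS (h : TreeInv M s) (hx : s.label x = Label.even) (hy : s.label y = Label.even)
    {w : V} (hw : Shrunk s x y b w) : s.InS w := by
  rw [← h.inS_base_iff]
  rcases hw with hw | hw
  · exact (h.anc_base_rep hw.1 (inS_of_even hx)).1
  · exact (h.anc_base_rep hw.1 (inS_of_even hy)).1

lemma Shrunk.anc {w : V} (hw : Shrunk s x y b w) : s.Anc (s.base w) b := by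
  rcases hw with hw | hw <;> exact hw.2

lemma shrunk_lca (h : TreeInv M s) (hx : s.label x = Label.even) (hb : s.IsLCA x y b) :
    Shrunk s x y b b := by
  have := (h.anc_base_rep hb.1 (inS_of_even hx)).2
  exact Or.inl ⟨by rw [this]; exact hb.1, by rw [this]; exact .refl⟩

lemma Shrunk.mate (h : TreeInv M s) (hM : M.IsMatching) (hx : s.label x = Label.even)
    (hy : s.label y = Label.even) {o m : V} (hw : Shrunk s x y b o)
    (ho : s.label o = Label.odd) (hm : M.Adj o m) : Shrunk s x y b m := by
  rcases hw with hw | hw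
  · exact Or.inl (h.onPath_mate hM hx ho hw hm).1
  · exact Or.inr (h.onPath_mate hM hy ho hw hm).1

lemma Shrunk.parent {w p : V} (hw : Shrunk s x y b w) (hbw : s.base w = w) (hne : w ≠ b)
    (hp : s.parent w = some p) : Shrunk s x y b p := by
  have hanc := hw.anc
  rw [hbw] at hanc
  rcases Relation.ReflTransGen.cases_head hanc with rfl | ⟨d, ⟨p', hp', rfl⟩, hdb⟩
  · exact absurd rfl hne
  · obtain rfl : p = p' := by rw [hp] at hp'; simpa using hp'
    rcases hw with hw | hw
    · exact Or.inl ⟨hw.1.trans (by rw [hbw]; exact .single ⟨p, hp, rfl⟩), hdb⟩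
    · exact Or.inr ⟨hw.1.trans (by rw [hbw]; exact .single ⟨p, hp, rfl⟩), hdb⟩

lemma Shrunk.eq_of_parent_eq_none {w : V} (hw : Shrunk s x y b w) (hbw : s.base w = w)
    (hp : s.parent w = none) : w = b := by
  have hanc := hw.anc
  rw [hbw] at hanc
  rcases Relation.ReflTransGen.cases_head hanc with rfl | ⟨d, ⟨p', hp', rfl⟩, hdb⟩
  · rfl
  · rw [hp] at hp'; cases hp'

/-- Contracted nodes lie at or below `b`, while the parent node of `b` is strictly higher. It
therefore keeps its label and canonical path. -/
lemma not_shrunk_parent_lca (h : TreeInv M s) (hbb : s.base b = b) {p : V}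
    (hp : s.parent b = some p) : ¬ Shrunk s x y b p := by
  intro hw
  have hn : s.NodeParent b (s.base p) := ⟨p, hp, rfl⟩
  have h1 := h.length_canon_lt hn hbb
  have h2 := h.nodeParent_inS hn
  have h3 := h.length_canon_le hw.anc h2.2.1 h2.2.2
  omega

end Shrunk

/-- The contracted set contains the mates of its odd vertices, and its only entry from above is at
`b`. Thus everything but the base is matched inside. All canonical paths of the new node extend that
of `b` within the node. -/
lemma shrink (h : TreeInv M s) (hM : M.IsMatching) {x y b : V} {kx ky : ℕ}
    (hadj : G.Adj x y) (hxy : ¬ M.Adj x y) (hx : s.label x = Label.even)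
    (hy : s.label y = Label.even) (hkx : s.lcp x = some kx) (hky : s.lcp y = some ky)
    (hb : s.IsLCA x y b) : TreeInv M (s.shrink x y b kx ky) := by
  have hbb : s.base b = b := (h.anc_base_rep hb.1 (inS_of_even hx)).2
  have hbl := h.label_lca hM hx hy hb
  have hSb := shrunk_lca h hx hb
  have hb' : s.IsLCA y x b := ⟨hb.2.1, hb.1, fun c h1 h2 => hb.2.2 c h2 h1⟩
  have hyx : ¬ M.Adj y x := fun h => hxy h.symm
  set t := s.shrink x y b kx ky with ht
  have base_pos : ∀ {w}, Shrunk s x y b w → t.base w = b := fun {w} hw => if_pos hw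
  have base_neg : ∀ {w}, ¬ Shrunk s x y b w → t.base w = s.base w := fun {w} hw => if_neg hw
  have label_pos : ∀ {w}, Shrunk s x y b w → t.label w = Label.even := fun {w} hw => if_pos hw
  have label_neg : ∀ {w}, ¬ Shrunk s x y b w → t.label w = s.label w := fun {w} hw => if_neg hw
  have label_even : ∀ {w}, s.label w = Label.even → t.label w = Label.even := by
    intro w hw
    by_cases hS : Shrunk s x y b w
    · exact label_pos hS
    · rw [label_neg hS, hw]
  have lcp_neg : ∀ {w}, ¬ (s.label w = Label.odd ∧ Shrunk s x y b w) → t.lcp w = s.lcp w :=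
    fun {w} hw => if_neg hw
  have lcp_pos : ∀ {w}, s.label w = Label.odd → Shrunk s x y b w →
      t.lcp w = (s.lcpOdd w).map (fun o => kx + 1 + ky - o) := fun {w} h1 h2 => if_pos ⟨h1, h2⟩
  have canon_neg : ∀ {w}, ¬ (s.label w = Label.odd ∧ Shrunk s x y b w) →
      t.canon w = s.canon w := by
    intro w hw
    have h1 : ¬ (s.label w = Label.odd ∧ s.OnPath y b w) := fun h => hw ⟨h.1, Or.inr h.2⟩
    have h2 : ¬ (s.label w = Label.odd ∧ s.OnPath x b w) := fun h => hw ⟨h.1, Or.inl h.2⟩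
    simp only [ht, State.shrink, if_neg h1, if_neg h2]
  have canon_even : ∀ {w}, s.label w = Label.even → t.canon w = s.canon w := by
    intro w hw
    refine canon_neg fun h => ?_
    rw [hw] at h
    cases h.1
  have canon_not : ∀ {w}, ¬ Shrunk s x y b w → t.canon w = s.canon w :=
    fun hw => canon_neg fun h => hw h.2
  have label_odd : ∀ {w}, t.label w = Label.odd → s.label w = Label.odd ∧ ¬ Shrunk s x y b w := by
    intro w hw
    by_cases hS : Shrunk s x y b w
    · rw [label_pos hS] at hw; cases hw
    · exact ⟨by rwa [label_neg hS] at hw, hS⟩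
  have inS : ∀ {w}, t.InS w ↔ s.InS w := by
    intro w
    by_cases hS : Shrunk s x y b w
    · simp [State.InS, label_pos hS]
      exact hS.inS h hx hy
    · simp [State.InS, label_neg hS]
  have shrunk_base : ∀ {w}, ¬ Shrunk s x y b w → ¬ Shrunk s x y b (s.base w) := by
    intro w hw
    rwa [shrunk_congr (h.base_base w)]
  have new : ∀ {z}, s.label z = Label.odd → Shrunk s x y b z → ∃ k, t.lcp z = some k ∧ Even k ∧
      APath M (t.canon z) k z ∧ ∃ q, t.canon z = s.canon b ++ q ∧
        ∀ w ∈ q, Shrunk s x y b w := by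
    intro z hz hS
    obtain ⟨o, _, ho, hoo, _⟩ := h.odd z hz
    have hl := lcp_pos hz hS
    rw [ho, Option.map_some] at hl
    obtain ⟨_, ex, hex, _⟩ := h.even x hx
    obtain ⟨_, ey, hey, _⟩ := h.even y hy
    rw [hkx] at ex; rw [hky] at ey
    obtain rfl := Option.some.inj ex
    obtain rfl := Option.some.inj ey
    have hke : o < kx ∨ o < ky → Even (kx + 1 + ky - o) := by
      intro hlt
      rw [Nat.even_sub (by omega)]
      simp only [Nat.even_add, hex, hey, Nat.not_even_one, Nat.not_even_iff_odd.2 hoo]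
      simp
    by_cases hzy : s.OnPath y b z
    · have hc : t.canon z = _ := if_pos ⟨hz, hzy⟩
      obtain ⟨h1, h2, h3, h4⟩ := h.shrink_path hM hadj hxy hx hy hkx hky hb hz ho hzy hc
      exact ⟨_, hl, hke (Or.inr h3), h1, h4⟩
    · have hzx : s.OnPath x b z := hS.resolve_right hzy
      have hc : t.canon z = _ := (if_neg fun h => hzy h.2).trans (if_pos ⟨hz, hzx⟩)
      obtain ⟨h1, h2, h3, q, h4, h5⟩ :=
        h.shrink_path hM hadj.symm hyx hy hx hky hkx hb' hz ho hzx hc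
      refine ⟨_, hl, hke (Or.inl h3), ?_, q, h4, fun w hw => (h5 w hw).symm⟩
      convert h1 using 1
      omega
  refine ⟨?_, ?_, ?_, ?_, ?_, ?_, ?_, ?_, ?_, ?_, ?_, ?_, ?_, ?_, ?_⟩
  · intro v hv
    obtain ⟨h1, h2, h3, h4, h5⟩ := h.free v hv
    refine ⟨label_even h1, ?_, (canon_even h1).trans h3, h4, ?_⟩
    · rw [lcp_neg, h2]
      rw [h1]
      rintro ⟨h, -⟩
      cases h
    · by_cases hS : Shrunk s x y b v
      · rw [base_pos hS, hS.eq_of_parent_eq_none h5 h4]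
      · rw [base_neg hS, h5]
  · intro v hv
    by_cases hS : Shrunk s x y b v
    · rw [label_pos hS] at hv; cases hv
    · rw [label_neg hS] at hv
      rw [base_neg hS]
      exact h.unlabeled v hv
  · intro v
    by_cases hS : Shrunk s x y b v
    · rw [base_pos hS, base_pos hSb]
    · rw [base_neg hS, base_neg (shrunk_base hS), h.base_base]
  · intro v hv
    by_cases hS : Shrunk s x y b v
    · rw [base_pos hS] at hv ⊢
      refine ⟨label_pos hS, label_pos hSb, ?_⟩
      -- A vertex that was no representative had its mate in its old node. An odd one has its mate
      -- as child on the tree path; an even representative other than `b` has its mate as odd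
      -- parent.
      by_cases hvv : s.base v = v
      · cases hl : s.label v with
        | unlabeled => exact absurd hl (hS.inS h hx hy)
        | odd =>
          have hnf : ¬ IsFree M v := fun hf => by
            rw [(h.free v hf).1] at hl; cases hl
          simp only [IsFree, not_forall, not_not] at hnf
          obtain ⟨m, hm⟩ := hnf
          exact ⟨m, hm, base_pos (hS.mate h hM hx hy hl hm)⟩
        | even =>
          have hnf : ¬ IsFree M v := fun hf =>
            hv (hS.eq_of_parent_eq_none hvv (h.free v hf).2.2.2.1).symm
          obtain ⟨p, hp, hpo⟩ := h.rep_parent v hvv hl hnf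
          exact ⟨p, (h.parent_odd v p hp hpo).symm, base_pos (hS.parent hvv (Ne.symm hv) hp)⟩
      · obtain ⟨-, -, w, hw, hw'⟩ := h.base_mate v hvv
        exact ⟨w, hw, base_pos ((shrunk_congr hw').2 hS)⟩
    · rw [base_neg hS] at hv ⊢
      obtain ⟨h1, h2, w, hw, hw'⟩ := h.base_mate v hv
      exact ⟨label_even h1, label_even h2, w, hw,
        by rw [base_neg (by rwa [shrunk_congr hw']), hw']⟩
  · intro v w hvw hv
    have hv' : ¬ s.InS v := by rw [← inS]; simpa [State.InS] using hv
    have := h.mate_unlabeled v w hvw (by simpa [State.InS] using hv')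
    have hw' : ¬ t.InS w := by rw [inS]; simpa [State.InS] using this
    simpa [State.InS] using hw'
  · intro v w hvw hv
    exact label_even (h.mate_odd v w hvw (label_odd hv).1)
  · intro v w hvw hv hw
    have key : ∀ v w, M.Adj v w → t.label v = Label.even → s.label v = Label.odd →
        t.base v = t.base w := by
      intro v w hvw hv hl
      have hS : Shrunk s x y b v := by
        by_contra hS
        rw [label_neg hS, hl] at hv
        cases hv
      rw [base_pos hS, base_pos (hS.mate h hM hx hy hl hvw)]
    have hvS : s.InS v := inS.1 (inS_of_even hv)
    have hwS : s.InS w := inS.1 (inS_of_even hw)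
    cases hlv : s.label v with
    | unlabeled => exact absurd hlv hvS
    | odd => exact key v w hvw hv hlv
    | even =>
      cases hlw : s.label w with
      | unlabeled => exact absurd hlw hwS
      | odd => exact (key w v hvw.symm hw hlw).symm
      | even =>
        have hbe := h.mate_even v w hvw hlv hlw
        by_cases hS : Shrunk s x y b v
        · rw [base_pos hS, base_pos ((shrunk_congr hbe).1 hS)]
        · rw [base_neg hS, base_neg (fun h => hS ((shrunk_congr hbe).2 h)), hbe]
  · intro v hv
    obtain ⟨h1, h2⟩ := label_odd hv
    rw [canon_not h2]
    exact h.odd v h1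
  · intro v hv
    have hvS : s.InS v := inS.1 (inS_of_even hv)
    cases hlv : s.label v with
    | unlabeled => exact absurd hlv hvS
    | odd =>
      have hS : Shrunk s x y b v := by
        by_contra hS
        rw [label_neg hS, hlv] at hv
        cases hv
      obtain ⟨k, h1, h2, h3, -⟩ := new hlv hS
      exact ⟨k, h1, h2, h3⟩
    | even =>
      rw [canon_even hlv, lcp_neg (by rw [hlv]; rintro ⟨h, -⟩; cases h)]
      exact h.even v hlv
  · intro v k hk
    by_cases hS : s.label v = Label.odd ∧ Shrunk s x y b v
    · exact label_pos hS.2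
    · rw [lcp_neg hS] at hk
      exact label_even (h.lcp_label v k hk)
  · intro v hv
    rw [inS] at hv
    by_cases hS : Shrunk s x y b v
    · rw [base_pos hS, canon_even hbl]
      cases hlv : s.label v with
      | unlabeled => exact absurd hlv hv
      | odd =>
        obtain ⟨k, -, -, -, q, h1, h2⟩ := new hlv hS
        exact ⟨q, h1, fun w hw => base_pos (h2 w hw)⟩
      | even =>
        obtain ⟨r, hr, hr'⟩ := h.canon_eq_append_of_anc hS.anc v hv rfl
        refine ⟨r, by rw [canon_even hlv, hr], fun w hw => base_pos ?_⟩
        rcases hS with hS | hS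
        · exact Or.inl ⟨hS.1.trans (hr' w hw).1, (hr' w hw).2⟩
        · exact Or.inr ⟨hS.1.trans (hr' w hw).1, (hr' w hw).2⟩
    · obtain ⟨q, h1, h2⟩ := h.canon_base v hv
      rw [base_neg hS, canon_not hS, canon_not (shrunk_base hS)]
      exact ⟨q, h1, fun w hw => by
        rw [base_neg (fun h => hS ((shrunk_congr (h2 w hw)).1 h)), h2 w hw]⟩
  · intro a p ha hp
    change s.parent a = some p at hp
    by_cases hS : Shrunk s x y b a
    · rw [base_pos hS] at ha
      subst ha
      rw [canon_even hbl, canon_not (h.not_shrunk_parent_lca hbb hp)]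
      exact h.parent_canon _ p hbb hp
    · rw [base_neg hS] at ha
      rw [canon_not hS, h.parent_canon a p ha hp, canon_neg]
      rintro ⟨h1, h2⟩
      exact hS (h2.mate h hM hx hy h1 (h.parent_odd a p hp h1))
  · intro a p hp
    rw [inS, inS]
    exact h.parent_inS a p hp
  · intro a p hp hl
    exact h.parent_odd a p hp (label_odd hl).1
  · intro c hc hl hf
    by_cases hS : Shrunk s x y b c
    · rw [base_pos hS] at hc
      subst hc
      obtain ⟨p, hp, hpo⟩ := h.rep_parent b hbb hbl hf
      exact ⟨p, hp, by rw [label_neg (h.not_shrunk_parent_lca hbb hp), hpo]⟩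
    · rw [base_neg hS] at hc
      rw [label_neg hS] at hl
      obtain ⟨p, hp, hpo⟩ := h.rep_parent c hc hl hf
      refine ⟨p, hp, ?_⟩
      rw [label_neg, hpo]
      intro h2
      exact hS (h2.mate h hM hx hy hpo (h.parent_odd c p hp hpo))

end TreeInv

/-! ### Consequences of the dual solution -/

namespace TreeInv

variable {s : State V} {y : V → ℤ} {z : V → V → ℤ}

lemma dual_free (h : TreeInv M s) (hy : DualValues s y) (f : V) (hf : IsFree M f) :
    y f = 1 - s.phase := by
  have h1 := h.free f hf
  rw [hy.2.1 f 0 h1.1 h1.2.1]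
  push_cast
  ring

lemma le_lcp_of_dual (h : TreeInv M s) (hd : IsDual M y z) (hy : DualValues s y) {v : V} {k : ℕ}
    (hk : (k : ℤ) ≤ y v + s.phase - 1) : (k : ℕ∞) ≤ Lcp M v := by
  refine le_lcp fun l j hp hj => ?_
  have := hd.le_of_aPath (h.dual_free hy) hp hj
  exact_mod_cast hk.trans this

/-- The canonical path bounds `Lcp` from above and the dual value bounds it from below. By
`DualValues` the two bounds coincide. -/
lemma lcp_eq (h : TreeInv M s) (hd : IsDual M y z) (hy : DualValues s y) {v : V} {k : ℕ}
    (hk : s.lcp v = some k) : Lcp M v = k := by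
  have hl := h.lcp_label v k hk
  obtain ⟨k', e, hke, hp⟩ := h.even v hl
  obtain rfl : k = k' := by rw [hk] at e; simpa using e
  refine le_antisymm (hp.lcp_le hke) (h.le_lcp_of_dual hd hy ?_)
  rw [hy.2.1 v k hl hk]
  linarith

/-- The dual bound is `Δ` for an unlabeled vertex and `2 * Δ - 1 - o` for an odd one, where `o + 1 ≤
Δ`. -/
lemma phase_le_lcp (h : TreeInv M s) (hd : IsDual M y z) (hy : DualValues s y) {v : V}
    (hv : s.label v ≠ Label.even) : (s.phase : ℕ∞) ≤ Lcp M v := by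
  refine h.le_lcp_of_dual hd hy ?_
  cases hl : s.label v with
  | unlabeled => rw [hy.1 v hl]; linarith
  | even => exact absurd hl hv
  | odd =>
    obtain ⟨o, _, ho, _, hop, _⟩ := h.odd v hl
    rw [hy.2.2 v o hl ho]
    omega

end TreeInv

namespace Inv

variable {s : State V}

lemma lcp_eq (h : Inv M s) {v : V} {k : ℕ} (hk : s.lcp v = some k) : Lcp M v = k := by
  obtain ⟨y, z, hd, hy, -⟩ := h.dual
  exact h.toTreeInv.lcp_eq hd hy hk

lemma phase_le_lcp (h : Inv M s) {v : V} (hv : s.label v ≠ Label.even) :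
    (s.phase : ℕ∞) ≤ Lcp M v := by
  obtain ⟨y, z, hd, hy, -⟩ := h.dual
  exact h.toTreeInv.phase_le_lcp hd hy hv

open Classical in
/-- The dual adjustment at the end of a completed phase. -/
lemma exists_dual_succ [Fintype V] (h : Inv M s) (hM : M.IsMatching) (hc : PhaseCompleted M s) :
    ∃ y z, IsDual M y z ∧ DualValues { s with phase := s.phase + 1 } y ∧
      ∀ u v, s.base u ≠ s.base v → z u v = 0 := by
  obtain ⟨y, z, hd, ⟨hy1, hy2, hy3⟩, hz⟩ := h.dual
  let δ : V → ℤ := fun v => match s.label v with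
    | Label.unlabeled => 0
    | Label.even => -1
    | Label.odd => 1
  have hδu : ∀ {v}, s.label v = Label.unlabeled → δ v = 0 := fun {v} hv => by simp [δ, hv]
  have hδe : ∀ {v}, s.label v = Label.even → δ v = -1 := fun {v} hv => by simp [δ, hv]
  have hδo : ∀ {v}, s.label v = Label.odd → δ v = 1 := fun {v} hv => by simp [δ, hv]
  let ι : V → V → ℤ := fun u v => if s.base u = s.base v then 1 else 0
  have hι0 : ∀ u v, 0 ≤ ι u v := fun u v => by simp only [ι]; split_ifs <;> norm_num
  have hι1 : ∀ {u v}, s.base u = s.base v → ι u v = 1 := fun {u v} h => if_pos h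
  have hι2 : ∀ {u v}, s.base u ≠ s.base v → ι u v = 0 := fun {u v} h => if_neg h
  have hne : ∀ {u v}, u ≠ v → s.label v ≠ Label.even → s.base u ≠ s.base v := by
    intro u v huv hv e
    rw [h.base_of_not_even hv] at e
    have := (h.base_mate u (by rw [e]; exact huv.symm)).2.1
    rw [e] at this
    exact hv this
  refine ⟨fun v => y v + δ v, fun u v => z u v + 2 * ι u v, ⟨?_, ?_, ?_⟩, ⟨?_, ?_, ?_⟩, ?_⟩
  · have key : ∀ u v, G.Adj u v → s.label u = Label.even → s.label v = Label.unlabeled →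
        0 ≤ y u + δ u + (y v + δ v) + (z u v + 2 * ι u v) := by
      intro u v huv hu hv
      have hb := hne huv.ne (by rw [hv]; simp)
      obtain ⟨k, hk, -⟩ := h.even u hu
      rw [hδe hu, hδu hv, hz _ _ hb, hι2 hb, hy1 v hv, hy2 u k hu hk]
      -- Otherwise the exhausted growth steps would have brought `v` into the search structure.
      -- Hence `k + 1 ≥ Δ`, which gives the required slack of 1.
      have : ¬ (k + 2 ≤ s.phase) := fun hlt =>
        (h.complete u v k hk huv (Or.inr ⟨hlt, by rw [hc.1]; simp⟩)).1 hv
      omega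
    have hb0 : ∀ {u v}, s.label u ≠ Label.even → u ≠ v → s.base u ≠ s.base v :=
      fun hu huv => (hne huv.symm hu).symm
    intro u v huv hMuv
    have hold := hd.nonneg u v huv hMuv
    have hι := hι0 u v
    cases hu : s.label u with
    | unlabeled =>
      cases hv : s.label v with
      | unlabeled => rw [hδu hu, hδu hv]; linarith
      | odd => rw [hδu hu, hδo hv]; linarith
      | even =>
        have := key v u huv.symm hv hu
        have hb := hb0 (u := u) (v := v) (by rw [hu]; simp) huv.ne
        rw [hz _ _ hb, hι2 hb]
        rw [hz _ _ hb.symm, hι2 hb.symm] at this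
        linarith
    | odd =>
      cases hv : s.label v with
      | unlabeled => rw [hδo hu, hδu hv]; linarith
      | odd => rw [hδo hu, hδo hv]; linarith
      | even => rw [hδo hu, hδe hv]; linarith
    | even =>
      cases hv : s.label v with
      | unlabeled => exact key u v huv hu hv
      | odd => rw [hδe hu, hδo hv]; linarith
      | even =>
        rw [hδe hu, hδe hv]
        by_cases hb : s.base u = s.base v
        · rw [hι1 hb]; linarith
        · obtain ⟨k, hk, hke, -⟩ := h.even u hu
          obtain ⟨j, hj, hje, -⟩ := h.even v hv
          rw [hz _ _ hb] at hold ⊢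
          rw [hy2 u k hu hk, hy2 v j hv hj] at hold ⊢
          -- The slack `k + j + 2 - 2 * Δ` is even and nonnegative, and it is nonzero because no
          -- bridge is left. So it is at least 2, exactly what the adjustment consumes.
          have : ¬ (k + j + 2 = 2 * s.phase) := fun e =>
            hc.2 u v ⟨huv, hMuv, hu, hv, hb, k, j, hk, hj, e⟩
          obtain ⟨k', rfl⟩ := hke
          obtain ⟨j', rfl⟩ := hje
          push_cast at hold ⊢
          omega
  · have key : ∀ u v, M.Adj u v → s.label u = Label.odd →
        y u + δ u + (y v + δ v) + (z u v + 2 * ι u v) = 2 := by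
      intro u v huv hu
      have hold := hd.tight u v huv
      have hv := h.mate_odd u v huv hu
      rw [hδo hu, hδe hv, hι2 (hne huv.adj_sub.ne.symm (by rw [hu]; simp)).symm]
      linarith
    intro u v huv
    have hold := hd.tight u v huv
    cases hu : s.label u with
    | unlabeled =>
      have hv := h.mate_unlabeled u v huv hu
      rw [hδu hu, hδu hv, hι2 (hne huv.adj_sub.ne (by rw [hv]; simp))]
      linarith
    | odd => exact key u v huv hu
    | even =>
      cases hv : s.label v with
      | unlabeled => rw [h.mate_unlabeled v u huv.symm hv] at hu; cases hu
      | odd =>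
        rw [hδe hu, hδo hv, hι2 (hne huv.adj_sub.ne (by rw [hv]; simp))]
        linarith
      | even =>
        rw [hδe hu, hδe hv, hι1 (h.mate_even u v huv hu hv)]
        linarith
  · exact hd.nonpos.add ((nonposAltSum_partition
      (fun v hv => (h.base_mate v hv).2.2) hM).mul (by norm_num))
  · intro v hv
    simp only at hv ⊢
    rw [hδu hv, hy1 v hv, add_zero]
  · intro v k hv hk
    simp only at hv hk ⊢
    rw [hδe hv, hy2 v k hv hk]
    push_cast
    ring
  · intro v k hv hk
    simp only at hv hk ⊢
    rw [hδo hv, hy3 v k hv hk]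
    push_cast
    ring
  · intro u v hb
    simp only
    rw [hz u v hb, hι2 hb]
    norm_num

/-! ### The invariant is preserved -/

lemma init : Inv M (State.init M) := by
  classical
  have hfe : ∀ {v}, IsFree M v → (State.init M).label v = Label.even := fun {v} hv => if_pos hv
  have hfu : ∀ {v}, ¬ IsFree M v → (State.init M).label v = Label.unlabeled :=
    fun {v} hv => if_neg hv
  have hef : ∀ {v}, (State.init M).label v = Label.even → IsFree M v := by
    intro v hv
    by_contra hf
    rw [hfu hf] at hv; cases hv
  have hno : ∀ {v}, (State.init M).label v ≠ Label.odd := by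
    intro v hv
    by_cases hf : IsFree M v
    · rw [hfe hf] at hv; cases hv
    · rw [hfu hf] at hv; cases hv
  have hSf : ∀ {v}, (State.init M).InS v → IsFree M v := by
    intro v hv
    by_contra hf
    exact hv (hfu hf)
  have hlcp : ∀ {v}, IsFree M v → (State.init M).lcp v = some 0 := fun {v} hv => if_pos hv
  have hlf : ∀ {v k}, (State.init M).lcp v = some k → IsFree M v ∧ k = 0 := by
    intro v k hk
    by_cases hf : IsFree M v
    · rw [hlcp hf] at hk; exact ⟨hf, by simpa using hk.symm⟩
    · rw [show (State.init M).lcp v = none from if_neg hf] at hk; cases hk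
  have hcan : ∀ {v}, IsFree M v → (State.init M).canon v = [v] := fun {v} hv => if_pos hv
  refine ⟨⟨fun v hv => ⟨hfe hv, hlcp hv, hcan hv, rfl, rfl⟩, fun v _ => ⟨rfl, rfl⟩, fun v => rfl,
    fun v hv => absurd rfl hv, ?_, ?_, ?_, ?_, ?_, ?_, ?_, ?_, ?_, ?_, ?_⟩,
    ?_, ?_, ?_, ?_, ?_, ?_⟩
  · intro v w hvw _
    exact hfu fun hf => hf v hvw.symm
  · intro v w _ hv
    exact absurd hv hno
  · intro v w hvw hv _
    exact absurd hvw (hef hv w)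
  · intro v hv
    exact absurd hv hno
  · intro v hv
    have hf := hef hv
    rw [hcan hf]
    exact ⟨0, hlcp hf, by simp, aPath_singleton hf⟩
  · intro v k hk
    exact hfe (hlf hk).1
  · intro v _
    exact ⟨[], by simp [State.init], by simp⟩
  · intro a p _ hp
    cases hp
  · intro a p hp
    cases hp
  · intro a p hp
    cases hp
  · intro b _ hb hf
    exact absurd (hef hb) hf
  · intro v k hk
    cases hk
  · intro v hv
    exact ⟨_, 0, aPath_singleton (hSf hv), Nat.zero_le _⟩
  · intro v k hk _
    obtain ⟨-, rfl⟩ := hlf hk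
    exact ⟨Nat.zero_le _, fun m _ => by simp⟩
  · intro u v k _ _ hlt
    have : (State.init M).phase = 0 := rfl
    omega
  · refine ⟨fun _ => 1, fun _ _ => 0, ⟨fun _ _ _ _ => by norm_num, fun _ _ _ => by norm_num, ?_⟩,
      ⟨fun _ _ => rfl, ?_, fun v k hv _ => absurd hv hno⟩, fun _ _ _ => rfl⟩
    · intro l k v hp hk
      have := altSum_mul 0 (fun _ _ => 0) l
      simp only [zero_mul] at this
      exact this.le
    · intro v k _ hk
      obtain ⟨-, rfl⟩ := hlf hk
      simp [State.init]
  · intro x y h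
    cases h

end Inv

/-- The tree invariant does not depend on the stage, and is monotone in the phase. -/
lemma TreeInv.of_phase_le {s : State V} (h : TreeInv M s) {n : ℕ} (hn : s.phase ≤ n)
    (st : Stage V) : TreeInv M { s with phase := n, stage := st } := by
  refine {
    free := h.free, unlabeled := h.unlabeled, base_base := h.base_base,
    base_mate := h.base_mate, mate_unlabeled := h.mate_unlabeled, mate_odd := h.mate_odd,
    mate_even := h.mate_even, odd := ?_, even := h.even, lcp_label := h.lcp_label,
    canon_base := h.canon_base, parent_canon := h.parent_canon, parent_inS := h.parent_inS,
    parent_odd := h.parent_odd, rep_parent := h.rep_parent }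
  intro v hv
  obtain ⟨o, p, h1, h2, h3, h4⟩ := h.odd v hv
  exact ⟨o, p, h1, h2, h3.trans hn, h4⟩

/-! ### Invariance under changes of phase and stage, and under contraction. -/

namespace Inv

variable {s : State V}

lemma nextPhase [Fintype V] (h : Inv M s) (hM : M.IsMatching) (hc : PhaseCompleted M s)
    {st : Stage V} (hst : st = if Even (s.phase + 1) then Stage.growing else Stage.bridging) :
    Inv M { s with phase := s.phase + 1, stage := st } := by
  refine {
    toTreeInv := h.toTreeInv.of_phase_le (Nat.le_succ _) st,
    lcpOdd_eq := h.lcpOdd_eq, reach := ?_, bornEven := ?_, complete := ?_,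
    dual := h.exists_dual_succ hM hc, found := ?_ }
  · intro v hv
    obtain ⟨l, k, h1, h2⟩ := h.reach v hv
    exact ⟨l, k, h1, h2.trans (Nat.le_succ _)⟩
  · intro v k hk hn
    obtain ⟨h1, h2⟩ := h.bornEven v k hk hn
    exact ⟨h1.trans (Nat.le_succ _), h2⟩
  · intro u v k hk huv hlt
    refine h.complete u v k hk huv (Or.inr ⟨?_, by rw [hc.1]; simp⟩)
    simp only at hlt
    rcases hlt with hlt | ⟨hlt, hne⟩
    · omega
    · obtain ⟨k', e, hke, -⟩ := h.even u (h.lcp_label u k hk)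
      obtain rfl : k = k' := by
        change s.lcp u = some k at hk
        rw [hk] at e; simpa using e
      -- The new phase is odd if it does not begin with growth steps, and `k` is even. So no vertex
      -- is due for growth in it.
      have : ¬ Even (s.phase + 1) := fun he => by rw [hst, if_pos he] at hne; exact hne rfl
      have hne' : k + 2 ≠ s.phase + 1 := fun e => by
        rw [← e] at this
        exact this (hke.add even_two)
      omega
  · intro x y hxy
    simp only [hst] at hxy
    split_ifs at hxy

/-- The invariant is kept when only the stage changes, at the end of the growth steps or later. -/
lemma of_stage (h : Inv M s) {st : Stage V}
    (hcomp : s.stage = Stage.growing → ∀ u v k, s.lcp u = some k → G.Adj u v → k + 2 = s.phase →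
      s.InS v ∧ ∀ l, s.lcp v = some l → s.lcpOdd v = none → ¬ M.Adj u v → l ≤ k)
    (hf : ∀ x y, st = Stage.found x y → s.IsBridge M x y ∧ ¬ s.SameTree x y) :
    Inv M { s with stage := st } := by
  refine {
    toTreeInv := h.toTreeInv.of_phase_le le_rfl st,
    lcpOdd_eq := h.lcpOdd_eq, reach := h.reach, bornEven := h.bornEven, complete := ?_,
    dual := h.dual, found := hf }
  intro u v k hk huv hlt
  have hle : k + 2 ≤ s.phase := by
    rcases hlt with hlt | hlt
    · exact Nat.le_of_lt hlt
    · exact hlt.1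
  by_cases hg : s.stage = Stage.growing
  · rcases hle.lt_or_eq with hlt | he
    · exact h.complete u v k hk huv (Or.inl hlt)
    · exact hcomp hg u v k hk huv he
  · exact h.complete u v k hk huv (Or.inr ⟨hle, hg⟩)

lemma not_isFree_of_not_even (h : TreeInv M s) {v : V} (hv : s.label v ≠ Label.even) :
    ∃ m, M.Adj v m := by
  by_contra hn
  push Not at hn
  exact hv (h.free v hn).1

lemma endGrowth (h : Inv M s) (hno : ∀ t, ¬ GrowthStep M s t) :
    Inv M { s with stage := Stage.bridging } := by
  refine h.of_stage ?_ (by simp)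
  intro hg u v k hk huv he
  have hu := h.lcp_label u k hk
  have hS : s.InS v := by
    intro hv
    obtain ⟨m, hm⟩ := not_isFree_of_not_even h.toTreeInv (v := v) (by rw [hv]; simp)
    exact hno _ (GrowthStep.extend s u v m k hg hu hk he huv hv hm)
  refine ⟨hS, fun l hl hn hMuv => ?_⟩
  have hv := h.lcp_label v l hl
  obtain ⟨h1, -⟩ := h.bornEven v l hl hn
  -- A value equal to `Δ` would still allow a growth step of the second kind. Since `l ≤ Δ = k + 2`
  -- and both values are even, `l ≤ k` follows.
  have h2 : l ≠ s.phase := by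
    rintro rfl
    exact hno _ (GrowthStep.second s u v k hg hu hk he huv hMuv hv hl hn)
  obtain ⟨k', e, hke, -⟩ := h.even u hu
  obtain rfl : k = k' := by rw [hk] at e; simpa using e
  obtain ⟨l', e', hle, -⟩ := h.even v hv
  obtain rfl : l = l' := by rw [hl] at e'; simpa using e'
  obtain ⟨i, rfl⟩ := hke
  obtain ⟨j, rfl⟩ := hle
  omega

/-- The old dual solution still works. A bridge has `kx + ky + 2 = 2 * Δ`, so a new even vertex gets
`lcp = 2 * Δ - 1 - o`; its even dual value is `Δ - o`, which is its old odd one. -/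
lemma shrink (h : Inv M s) (hM : M.IsMatching) {x y b : V} {kx ky : ℕ}
    (hst : s.stage = Stage.bridging) (hbr : s.IsBridge M x y) (hkx : s.lcp x = some kx)
    (hky : s.lcp y = some ky) (hb : s.IsLCA x y b) : Inv M (s.shrink x y b kx ky) := by
  obtain ⟨hadj, hxy, hx, hy, -, kx', ky', ex, ey, hsum⟩ := hbr
  obtain rfl : kx = kx' := by rw [hkx] at ex; simpa using ex
  obtain rfl : ky = ky' := by rw [hky] at ey; simpa using ey
  have hT := h.toTreeInv.shrink hM hadj hxy hx hy hkx hky hb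
  have label_neg : ∀ {w}, ¬ TreeInv.Shrunk s x y b w →
      (s.shrink x y b kx ky).label w = s.label w := fun {w} hw => if_neg hw
  have label_pos : ∀ {w}, TreeInv.Shrunk s x y b w →
      (s.shrink x y b kx ky).label w = Label.even := fun {w} hw => if_pos hw
  have inS : ∀ {w}, (s.shrink x y b kx ky).InS w ↔ s.InS w := by
    intro w
    by_cases hS : TreeInv.Shrunk s x y b w
    · simp [State.InS, label_pos hS]
      exact hS.inS h.toTreeInv hx hy
    · simp [State.InS, label_neg hS]
  have lcp_cases : ∀ {v k}, (s.shrink x y b kx ky).lcp v = some k →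
      s.lcp v = some k ∨ s.label v = Label.odd ∧ ∃ o, s.lcpOdd v = some o ∧ o + 1 ≤ s.phase ∧
        k = kx + 1 + ky - o := by
    intro v k hk
    by_cases hS : s.label v = Label.odd ∧ TreeInv.Shrunk s x y b v
    · right
      obtain ⟨o, _, ho, _, hop, _⟩ := h.odd v hS.1
      have : (s.shrink x y b kx ky).lcp v = _ := if_pos hS
      rw [this, ho, Option.map_some] at hk
      exact ⟨hS.1, o, ho, hop, by simpa using hk.symm⟩
    · left
      have : (s.shrink x y b kx ky).lcp v = _ := if_neg hS
      rwa [this] at hk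
  refine {
    toTreeInv := hT, lcpOdd_eq := h.lcpOdd_eq, reach := fun v hv => h.reach v (inS.1 hv),
    bornEven := ?_, complete := ?_, dual := ?_, found := ?_ }
  · intro v k hk hn
    rcases lcp_cases hk with hk | ⟨-, o, ho, -⟩
    · exact h.bornEven v k hk hn
    · change s.lcpOdd v = none at hn
      rw [hn] at ho; cases ho
  · intro u v k hk huv hlt
    change k + 2 < s.phase ∨ k + 2 ≤ s.phase ∧ s.stage ≠ Stage.growing at hlt
    rcases lcp_cases hk with hk | ⟨-, o, ho, hop, rfl⟩
    · obtain ⟨h1, h2⟩ := h.complete u v k hk huv hlt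
      refine ⟨inS.2 h1, fun l hl hn => ?_⟩
      rcases lcp_cases hl with hl | ⟨-, o, ho, -⟩
      · exact h2 l hl hn
      · change s.lcpOdd v = none at hn
        rw [hn] at ho; cases ho
    -- A vertex turned even has `lcp = 2 * Δ - 1 - o ≥ Δ`, so it is not yet due for growth.
    · exfalso
      omega
  · obtain ⟨Y, Z, hd, ⟨h1, h2, h3⟩, hz⟩ := h.dual
    refine ⟨Y, Z, hd, ⟨?_, ?_, ?_⟩, ?_⟩
    · intro v hv
      refine h1 v ?_
      have : ¬ s.InS v := by rw [← inS]; simpa [State.InS] using hv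
      simpa [State.InS] using this
    · intro v k hv hk
      change Y v = k - s.phase + 1
      rcases lcp_cases hk with hk | ⟨hl, o, ho, hop, rfl⟩
      · exact h2 v k (h.lcp_label v k hk) hk
      · rw [h3 v o hl ho]
        omega
    · intro v k hv hk
      refine h3 v k ?_ hk
      by_cases hS : TreeInv.Shrunk s x y b v
      · rw [label_pos hS] at hv; cases hv
      · rwa [label_neg hS] at hv
    · intro u v huv
      refine hz u v fun e => huv ?_
      have := TreeInv.shrunk_congr (x := x) (y := y) (b := b) e
      simp only [State.shrink]
      by_cases hS : TreeInv.Shrunk s x y b u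
      · rw [if_pos hS, if_pos (this.1 hS)]
      · rw [if_neg hS, if_neg (fun h => hS (this.2 h)), e]
  · intro x' y' hf
    change s.stage = _ at hf
    rw [hst] at hf
    cases hf

end Inv

/-! ### Invariance under growth steps. -/

namespace TreeInv

variable {s : State V}

lemma ne_of_inS {u x : V} (hu : s.InS u) (hx : s.label x = Label.unlabeled) : u ≠ x := by
  rintro rfl
  exact hu hx

/-- The extension of a canonical path by an unlabeled vertex. -/
lemma snoc_unlabeled (h : TreeInv M s) (hM : M.IsMatching) {v x y : V} {k : ℕ}
    (hv : s.label v = Label.even) (hk : s.lcp v = some k) (hvx : G.Adj v x)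
    (hx : s.label x = Label.unlabeled) (hxy : M.Adj x y) :
    Even k ∧ APath M (s.canon v ++ [x]) (k + 1) x ∧
      APath M (s.canon v ++ [x, y]) (k + 2) y := by
  obtain ⟨k', e, hke, hp⟩ := h.even v hv
  obtain rfl : k = k' := by rw [hk] at e; simpa using e
  have hy := h.mate_unlabeled x y hxy hx
  have hnot : ∀ {w}, s.label w = Label.unlabeled → w ∉ s.canon v := fun {w} hw hmem =>
    h.inS_of_mem_canon (inS_of_even hv) hmem hw
  have hvM : ¬ M.Adj v x := fun hvx' => by
    rw [hM.eq_of_adj_right hvx' hxy.symm, hy] at hv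
    cases hv
  have h1 := hp.snoc (hnot hx) hvx (by simp [hvM, hke])
  have h2 := h1.snoc (w := y) (by simp [hnot hy, hxy.adj_sub.ne.symm]) hxy.adj_sub
    (by simp [hxy, hke.add_one])
  exact ⟨hke, h1, by simpa using h2⟩

lemma grow (h : TreeInv M s) (hM : M.IsMatching) {v x y : V} {k : ℕ}
    (hv : s.label v = Label.even) (hk : s.lcp v = some k) (hph : k + 2 = s.phase)
    (hvx : G.Adj v x) (hx : s.label x = Label.unlabeled) (hxy : M.Adj x y) :
    TreeInv M (s.grow v x y k) := by
  obtain ⟨hke, hpx, hpy⟩ := h.snoc_unlabeled hM hv hk hvx hx hxy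
  have hy := h.mate_unlabeled x y hxy hx
  have hne : x ≠ y := hxy.adj_sub.ne
  have hvS := inS_of_even hv
  have hvx' := ne_of_inS hvS hx
  have hvy' := ne_of_inS hvS hy
  have hbx : s.base x = x := h.base_of_not_even (by rw [hx]; simp)
  have hby : s.base y = y := h.base_of_not_even (by rw [hy]; simp)
  set t := s.grow v x y k with ht
  have label_x : t.label x = Label.odd := if_pos rfl
  have label_y : t.label y = Label.even := (if_neg hne.symm).trans (if_pos rfl)
  have label_o : ∀ {w}, w ≠ x → w ≠ y → t.label w = s.label w :=
    fun {w} h1 h2 => (if_neg h1).trans (if_neg h2)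
  have canon_x : t.canon x = s.canon v ++ [x] := if_pos rfl
  have canon_y : t.canon y = s.canon v ++ [x, y] := (if_neg hne.symm).trans (if_pos rfl)
  have canon_o : ∀ {w}, w ≠ x → w ≠ y → t.canon w = s.canon w :=
    fun {w} h1 h2 => (if_neg h1).trans (if_neg h2)
  have parent_x : t.parent x = some v := if_pos rfl
  have parent_y : t.parent y = some x := (if_neg hne.symm).trans (if_pos rfl)
  have parent_o : ∀ {w}, w ≠ x → w ≠ y → t.parent w = s.parent w :=
    fun {w} h1 h2 => (if_neg h1).trans (if_neg h2)
  have lcp_y : t.lcp y = some (k + 2) := if_pos rfl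
  have lcp_o : ∀ {w}, w ≠ y → t.lcp w = s.lcp w := fun {w} h => if_neg h
  have odd_x : t.lcpOdd x = some (k + 1) := if_pos rfl
  have odd_o : ∀ {w}, w ≠ x → t.lcpOdd w = s.lcpOdd w := fun {w} h => if_neg h
  have inS_ne : ∀ {w}, s.InS w → w ≠ x ∧ w ≠ y := fun {w} hw => ⟨ne_of_inS hw hx, ne_of_inS hw hy⟩
  have inS_mono : ∀ {w}, s.InS w → t.InS w := by
    intro w hw
    obtain ⟨h1, h2⟩ := inS_ne hw
    rw [State.InS, label_o h1 h2]
    exact hw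
  have even_ne : ∀ {w}, s.label w = Label.even → w ≠ x ∧ w ≠ y :=
    fun hw => inS_ne (inS_of_even hw)
  have label_even : ∀ {w}, s.label w = Label.even → t.label w = Label.even := by
    intro w hw
    rw [label_o (even_ne hw).1 (even_ne hw).2, hw]
  have even_cases : ∀ {w}, t.label w = Label.even → w = y ∨ s.label w = Label.even := by
    intro w hw
    by_cases h2 : w = y
    · exact Or.inl h2
    · right
      by_cases h1 : w = x
      · rw [h1, label_x] at hw; cases hw
      · rwa [label_o h1 h2] at hw
  have odd_cases : ∀ {w}, t.label w = Label.odd → w = x ∨ s.label w = Label.odd := by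
    intro w hw
    by_cases h1 : w = x
    · exact Or.inl h1
    · right
      by_cases h2 : w = y
      · rw [h2, label_y] at hw; cases hw
      · rwa [label_o h1 h2] at hw
  have unl : ∀ {w}, t.label w = Label.unlabeled →
      s.label w = Label.unlabeled ∧ w ≠ x ∧ w ≠ y := by
    intro w hw
    have h1 : w ≠ x := by rintro rfl; rw [label_x] at hw; cases hw
    have h2 : w ≠ y := by rintro rfl; rw [label_y] at hw; cases hw
    exact ⟨by rwa [label_o h1 h2] at hw, h1, h2⟩
  refine ⟨?_, ?_, h.base_base, ?_, ?_, ?_, ?_, ?_, ?_, ?_, ?_, ?_, ?_, ?_, ?_⟩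
  · intro w hw
    obtain ⟨h1, h2, h3, h4, h5⟩ := h.free w hw
    obtain ⟨n1, n2⟩ := even_ne h1
    exact ⟨label_even h1, (lcp_o n2).trans h2, (canon_o n1 n2).trans h3,
      (parent_o n1 n2).trans h4, h5⟩
  · intro w hw
    obtain ⟨h1, n1, n2⟩ := unl hw
    rw [parent_o n1 n2]
    exact h.unlabeled w h1
  · intro w hw
    obtain ⟨h1, h2, h3⟩ := h.base_mate w hw
    exact ⟨label_even h1, label_even h2, h3⟩
  · intro u w huw hu
    obtain ⟨h1, n1, n2⟩ := unl hu
    rw [label_o, h.mate_unlabeled u w huw h1]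
    · rintro rfl; exact n2 (hM.eq_of_adj_right huw hxy.symm)
    · rintro rfl; exact n1 (hM.eq_of_adj_right huw hxy)
  · intro u w huw hu
    rcases odd_cases hu with rfl | hu
    · rw [hM.eq_of_adj_left huw hxy, label_y]
    · exact label_even (h.mate_odd u w huw hu)
  · intro u w huw hu hw
    rcases even_cases hu with rfl | hu'
    · rw [hM.eq_of_adj_left huw hxy.symm, label_x] at hw
      cases hw
    · rcases even_cases hw with rfl | hw'
      · rw [hM.eq_of_adj_right huw hxy, label_x] at hu
        cases hu
      · exact h.mate_even u w huw hu' hw'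
  · intro w hw
    rcases odd_cases hw with rfl | hw
    · exact ⟨k + 1, v, odd_x, hke.add_one, hph.le, by rwa [canon_x], parent_x⟩
    · obtain ⟨n1, n2⟩ := inS_ne (inS_of_odd hw)
      rw [odd_o n1, canon_o n1 n2, parent_o n1 n2]
      exact h.odd w hw
  · intro w hw
    rcases even_cases hw with rfl | hw
    · exact ⟨k + 2, lcp_y, hke.add even_two, by rwa [canon_y]⟩
    · obtain ⟨n1, n2⟩ := inS_ne (inS_of_even hw)
      rw [lcp_o n2, canon_o n1 n2]
      exact h.even w hw
  · intro w j hw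
    by_cases n2 : w = y
    · rw [n2, label_y]
    · rw [lcp_o n2] at hw
      exact label_even (h.lcp_label w j hw)
  · intro w hw
    change ∃ q, t.canon w = t.canon (s.base w) ++ q ∧ ∀ u ∈ q, s.base u = s.base w
    by_cases n1 : w = x
    · exact ⟨[], by rw [n1, hbx]; simp, by simp⟩
    by_cases n2 : w = y
    · exact ⟨[], by rw [n2, hby]; simp, by simp⟩
    have hw' : s.InS w := by rwa [State.InS, label_o n1 n2] at hw
    obtain ⟨m1, m2⟩ := inS_ne ((h.inS_base_iff w).2 hw')
    rw [canon_o n1 n2, canon_o m1 m2]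
    exact h.canon_base w hw'
  · intro a p ha hp
    by_cases n1 : a = x
    · subst n1
      rw [parent_x] at hp
      obtain rfl := Option.some.inj hp
      rw [canon_x, canon_o hvx' hvy']
    by_cases n2 : a = y
    · subst n2
      rw [parent_y] at hp
      obtain rfl := Option.some.inj hp
      rw [canon_x, canon_y]
      simp
    rw [parent_o n1 n2] at hp
    obtain ⟨m1, m2⟩ := inS_ne (h.parent_inS a p hp).2
    rw [canon_o n1 n2, canon_o m1 m2]
    exact h.parent_canon a p ha hp
  · intro a p hp
    by_cases n1 : a = x
    · subst n1
      rw [parent_x] at hp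
      obtain rfl := Option.some.inj hp
      exact ⟨by simp [State.InS, label_x], inS_mono hvS⟩
    by_cases n2 : a = y
    · subst n2
      rw [parent_y] at hp
      obtain rfl := Option.some.inj hp
      exact ⟨by simp [State.InS, label_y], by simp [State.InS, label_x]⟩
    rw [parent_o n1 n2] at hp
    obtain ⟨h1, h2⟩ := h.parent_inS a p hp
    exact ⟨inS_mono h1, inS_mono h2⟩
  · intro a p hp hl
    by_cases n1 : a = x
    · subst n1
      rw [parent_x] at hp
      obtain rfl := Option.some.inj hp
      rw [label_even hv] at hl
      cases hl
    by_cases n2 : a = y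
    · subst n2
      rw [parent_y] at hp
      obtain rfl := Option.some.inj hp
      exact hxy
    rw [parent_o n1 n2] at hp
    obtain ⟨m1, m2⟩ := inS_ne (h.parent_inS a p hp).2
    rw [label_o m1 m2] at hl
    exact h.parent_odd a p hp hl
  · intro b hb hl hf
    rcases even_cases hl with rfl | hl
    · exact ⟨x, parent_y, label_x⟩
    · obtain ⟨n1, n2⟩ := inS_ne (inS_of_even hl)
      obtain ⟨p, hp, hpo⟩ := h.rep_parent b hb hl hf
      obtain ⟨m1, m2⟩ := inS_ne (inS_of_odd hpo)
      exact ⟨p, (parent_o n1 n2).trans hp, (label_o m1 m2).trans hpo⟩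

end TreeInv

namespace Inv

variable {s : State V}

/-- The dual value 1 of an unlabeled vertex agrees with the value of an odd vertex with `lcpOdd = Δ
- 1` and of an even vertex with `lcp = Δ`. So the dual solution is kept. -/
lemma grow (h : Inv M s) (hM : M.IsMatching) {v x y : V} {k : ℕ}
    (hst : s.stage = Stage.growing)
    (hv : s.label v = Label.even) (hk : s.lcp v = some k) (hph : k + 2 = s.phase)
    (hvx : G.Adj v x) (hx : s.label x = Label.unlabeled) (hxy : M.Adj x y) :
    Inv M (s.grow v x y k) := by
  obtain ⟨hke, hpx, hpy⟩ := h.snoc_unlabeled hM hv hk hvx hx hxy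
  have hy := h.mate_unlabeled x y hxy hx
  have hne : x ≠ y := hxy.adj_sub.ne
  have hT := h.toTreeInv.grow hM hv hk hph hvx hx hxy
  set t := s.grow v x y k with ht
  have label_x : t.label x = Label.odd := if_pos rfl
  have label_y : t.label y = Label.even := (if_neg hne.symm).trans (if_pos rfl)
  have label_o : ∀ {w}, w ≠ x → w ≠ y → t.label w = s.label w :=
    fun {w} h1 h2 => (if_neg h1).trans (if_neg h2)
  have lcp_y : t.lcp y = some (k + 2) := if_pos rfl
  have lcp_o : ∀ {w}, w ≠ y → t.lcp w = s.lcp w := fun {w} h => if_neg h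
  have odd_x : t.lcpOdd x = some (k + 1) := if_pos rfl
  have odd_o : ∀ {w}, w ≠ x → t.lcpOdd w = s.lcpOdd w := fun {w} h => if_neg h
  have inS_mono : ∀ {w}, s.InS w → t.InS w := by
    intro w hw
    rw [State.InS, label_o (TreeInv.ne_of_inS hw hx) (TreeInv.ne_of_inS hw hy)]
    exact hw
  have lcp_cases : ∀ {w j}, t.lcp w = some j → w = y ∧ j = k + 2 ∨ s.lcp w = some j := by
    intro w j hj
    by_cases n2 : w = y
    · left
      rw [n2, lcp_y] at hj
      exact ⟨n2, by simpa using hj.symm⟩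
    · right
      rwa [lcp_o n2] at hj
  have even_ne : ∀ {w j}, s.lcp w = some j → w ≠ x ∧ w ≠ y := fun {w j} hw =>
    ⟨TreeInv.ne_of_inS (TreeInv.inS_of_even (h.lcp_label w j hw)) hx,
      TreeInv.ne_of_inS (TreeInv.inS_of_even (h.lcp_label w j hw)) hy⟩
  refine ⟨hT, ?_, ?_, ?_, ?_, ?_, ?_⟩
  · intro w j hj
    by_cases n1 : w = x
    · rw [n1, odd_x] at hj
      obtain rfl := Option.some.inj hj
      subst n1
      refine le_antisymm (hpx.lcpOdd_le hke.add_one) ?_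
      -- The mate `y` is still unlabeled, so `Lcp M y` is at least `Δ`, and an odd path to its mate
      -- has length at least `Δ - 1`.
      have h1 := h.phase_le_lcp (v := y) (by rw [hy]; simp)
      have h2 := h1.trans (lcp_mate_le hM hxy)
      rw [← hph] at h2
      have h3 : ((k + 1 : ℕ) : ℕ∞) + 1 ≤ LcpOdd M w + 1 := by exact_mod_cast h2
      exact (ENat.add_le_add_iff_right (by simp)).1 h3
    · rw [odd_o n1] at hj
      exact h.lcpOdd_eq w j hj
  · intro w hw
    by_cases n1 : w = x
    · subst n1; exact ⟨_, _, hpx, by change k + 1 ≤ s.phase; omega⟩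
    by_cases n2 : w = y
    · subst n2; exact ⟨_, _, hpy, hph.le⟩
    rw [State.InS, label_o n1 n2] at hw
    exact h.reach w hw
  · intro w j hj hn
    rcases lcp_cases hj with ⟨rfl, rfl⟩ | hj
    · refine ⟨hph.le, fun m hm => ?_⟩
      rw [hM.eq_of_adj_left hm hxy.symm, hph]
      exact h.phase_le_lcp (by rw [hx]; simp)
    · rw [odd_o (even_ne hj).1] at hn
      exact h.bornEven w j hj hn
  · intro u w j hj huw hlt
    have hlt' : j + 2 < s.phase := by
      rcases hlt with hlt | hlt
      · exact hlt
      · exact absurd hst hlt.2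
    rcases lcp_cases hj with ⟨rfl, rfl⟩ | hj
    · omega
    · obtain ⟨h1, h2⟩ := h.complete u w j hj huw (Or.inl hlt')
      refine ⟨inS_mono h1, fun l hl hn => ?_⟩
      rcases lcp_cases hl with ⟨rfl, rfl⟩ | hl
      · exact absurd hy h1
      · rw [odd_o (even_ne hl).1] at hn
        exact h2 l hl hn
  · obtain ⟨Y, Z, hd, ⟨h1, h2, h3⟩, hz⟩ := h.dual
    refine ⟨Y, Z, hd, ⟨?_, ?_, ?_⟩, hz⟩
    · intro w hw
      refine h1 w ?_
      have n1 : w ≠ x := by rintro rfl; rw [label_x] at hw; cases hw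
      have n2 : w ≠ y := by rintro rfl; rw [label_y] at hw; cases hw
      rwa [label_o n1 n2] at hw
    · intro w j hw hj
      change Y w = j - s.phase + 1
      rcases lcp_cases hj with ⟨rfl, rfl⟩ | hj
      · rw [h1 w hy]; omega
      · exact h2 w j (h.lcp_label w j hj) hj
    · intro w j hw hj
      change Y w = s.phase - j
      by_cases n1 : w = x
      · rw [n1, odd_x] at hj
        obtain rfl := Option.some.inj hj
        rw [n1, h1 x hx]
        omega
      · rw [odd_o n1] at hj
        have n2 : w ≠ y := by rintro rfl; rw [label_y] at hw; cases hw
        rw [label_o n1 n2] at hw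
        exact h3 w j hw hj
  · intro a b hab
    change s.stage = _ at hab
    rw [hst] at hab
    cases hab

lemma setLcpOdd (h : Inv M s) (hM : M.IsMatching) {v x : V} {k : ℕ}
    (hv : s.label v = Label.even) (hk : s.lcp v = some k) (hph : k + 2 = s.phase)
    (hvx : G.Adj v x) (hvM : ¬ M.Adj v x) (hx : s.label x = Label.even)
    (hlx : s.lcp x = some s.phase) (hox : s.lcpOdd x = none) :
    Inv M (s.setLcpOdd x (k + 1)) := by
  have odd_x : (s.setLcpOdd x (k + 1)).lcpOdd x = some (k + 1) := if_pos rfl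
  have odd_o : ∀ {w}, w ≠ x → (s.setLcpOdd x (k + 1)).lcpOdd w = s.lcpOdd w :=
    fun {w} h => if_neg h
  have odd_none : ∀ {w}, (s.setLcpOdd x (k + 1)).lcpOdd w = none → s.lcpOdd w = none := by
    intro w hw
    by_cases n : w = x
    · rw [n, hox]
    · rwa [odd_o n] at hw
  refine ⟨?_, ?_, h.reach, fun w j hj hn => h.bornEven w j hj (odd_none hn), ?_, ?_, ?_⟩
  · refine {
      free := h.free, unlabeled := h.unlabeled, base_base := h.base_base,
      base_mate := h.base_mate, mate_unlabeled := h.mate_unlabeled, mate_odd := h.mate_odd,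
      mate_even := h.mate_even, odd := ?_, even := h.even, lcp_label := h.lcp_label,
      canon_base := h.canon_base, parent_canon := h.parent_canon, parent_inS := h.parent_inS,
      parent_odd := h.parent_odd, rep_parent := h.rep_parent }
    intro w hw
    change s.label w = _ at hw
    have n : w ≠ x := by rintro rfl; rw [hx] at hw; cases hw
    rw [odd_o n]
    exact h.odd w hw
  · intro w j hj
    by_cases n : w = x
    swap
    · rw [odd_o n] at hj
      exact h.lcpOdd_eq w j hj
    subst n
    rw [odd_x] at hj
    obtain rfl := Option.some.inj hj
    obtain ⟨k', e, hke, hp⟩ := h.even v hv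
    obtain rfl : k = k' := by rw [hk] at e; simpa using e
    have hb := (h.bornEven w _ hlx hox).2
    -- If `w` were on the canonical path of `v`, then `w` or its mate would be reached by an even
    -- path of length at most `Δ - 2`. Both have `Lcp` at least `Δ`.
    have hwnot : w ∉ s.canon v := by
      intro hmem
      rcases hp.mem_cases hke hmem with ⟨l, j, hpj, hje, hjk⟩ | ⟨l, j, m, hwm, hpj, hje, hjk⟩
      · have h1 := hpj.lcp_le hje
        rw [h.lcp_eq hlx] at h1
        have : s.phase ≤ j := by exact_mod_cast h1
        omega
      · have h1 := (hb m hwm).trans (hpj.lcp_le hje)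
        have : s.phase ≤ j := by exact_mod_cast h1
        omega
    refine le_antisymm ((hp.snoc hwnot hvx (by simp [hvM, hke])).lcpOdd_le hke.add_one) ?_
    have hnf : ∃ m, M.Adj w m := by
      by_contra hn
      push Not at hn
      have := (h.free w hn).2.1
      rw [hlx] at this
      have := Option.some.inj this
      omega
    obtain ⟨m, hm⟩ := hnf
    have h2 := (hb m hm).trans (lcp_mate_le hM hm)
    rw [← hph] at h2
    have h3 : ((k + 1 : ℕ) : ℕ∞) + 1 ≤ LcpOdd M w + 1 := by exact_mod_cast h2
    exact (ENat.add_le_add_iff_right (by simp)).1 h3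
  · intro u w j hj huw hlt
    obtain ⟨h1, h2⟩ := h.complete u w j hj huw hlt
    exact ⟨h1, fun l hl hn => h2 l hl (odd_none hn)⟩
  · obtain ⟨Y, Z, hd, ⟨h1, h2, h3⟩, hz⟩ := h.dual
    refine ⟨Y, Z, hd, ⟨h1, h2, ?_⟩, hz⟩
    intro w j hw hj
    change s.label w = _ at hw
    have n : w ≠ x := by rintro rfl; rw [hx] at hw; cases hw
    rw [odd_o n] at hj
    exact h3 w j hw hj
  · exact h.found

lemma step [Fintype V] (hM : M.IsMatching) (h : Inv M s) {t : State V} (hst : Step M s t) :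
    Inv M t := by
  cases hst with
  | growth _ hg =>
    cases hg with
    | extend v x y k h1 h2 h3 h4 h5 h6 h7 => exact h.grow hM h1 h2 h3 h4 h5 h6 h7
    | second v x k h1 h2 h3 h4 h5 h6 h7 h8 h9 => exact h.setLcpOdd hM h2 h3 h4 h5 h6 h7 h8 h9
  | endGrowth h1 h2 => exact h.endGrowth h2
  | bridge _ x y hb =>
    cases hb with
    | blossom b kx ky h1 h2 h3 h4 h5 h6 => exact h.shrink hM h1 h2 h3 h4 h6
    | augment h1 h2 h3 =>
      refine h.of_stage (fun hg => by rw [h1] at hg; cases hg) ?_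
      intro a b hab
      cases hab
      exact ⟨h2, h3⟩
  | nextPhase h1 h2 => exact h.nextPhase hM h1 rfl
  | giveUp h1 h2 =>
    exact h.of_stage (fun hg => by rw [h1.1] at hg; cases hg) (by simp)

lemma of_reachable [Fintype V] (hM : M.IsMatching) (h : Reachable M s) : Inv M s := by
  induction h with
  | refl => exact Inv.init
  | tail _ h2 ih => exact ih.step hM h2

end Inv

variable {s : State V}

/-! ### Termination -/

/-- The position of a stage within a phase. -/
def Stage.rank : Stage V → ℕ
  | Stage.growing => 0
  | Stage.bridging => 1
  | Stage.found _ _ => 2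
  | Stage.exhausted => 2

lemma Stage.rank_le (st : Stage V) : st.rank ≤ 2 := by
  cases st <;> simp [Stage.rank]

/-- A measure of progress that grows in every step. -/
noncomputable def State.progress (s : State V) : ℕ :=
  3 * s.phase + s.stage.rank + {v | s.InS v}.ncard +
    {v | s.lcpOdd v ≠ none}.ncard +
    {v | s.base v ≠ v}.ncard

section Termination

variable [Fintype V]

lemma ncard_le_of_imp {p q : V → Prop} (h : ∀ v, p v → q v) :
    {v | p v}.ncard ≤ {v | q v}.ncard :=
  Set.ncard_le_ncard (fun v hv => h v hv) (Set.toFinite _)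

lemma ncard_lt_of_imp {p q : V → Prop} (h : ∀ v, p v → q v) {a : V} (hq : q a) (hp : ¬ p a) :
    {v | p v}.ncard < {v | q v}.ncard :=
  Set.ncard_lt_ncard ⟨fun v hv => h v hv, fun hsub => hp (hsub hq)⟩ (Set.toFinite _)

lemma Inv.progress_lt (h : Inv M s) {t : State V} (hst : Step M s t) :
    s.progress < t.progress := by
  unfold State.progress
  cases hst with
  | growth _ hg =>
    cases hg with
    | extend v x y k h1 h2 h3 h4 h5 h6 h7 =>
      have e1 : {v | s.InS v}.ncard <
          {w | (s.grow v x y k).InS w}.ncard := by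
        refine ncard_lt_of_imp (fun w hw => ?_) (a := x) ?_ (by simp [State.InS, h6])
        · simp only [State.InS, State.grow]
          split_ifs <;> simp_all [State.InS]
        · simp [State.InS, State.grow]
      have e2 : {v | s.lcpOdd v ≠ none}.ncard ≤
          {w | (s.grow v x y k).lcpOdd w ≠ none}.ncard := by
        refine ncard_le_of_imp fun w hw => ?_
        simp only [State.grow]
        split_ifs
        · simp
        · exact hw
      have e3 : (s.grow v x y k).base = s.base := rfl
      have e4 : (s.grow v x y k).phase = s.phase := rfl
      have e5 : (s.grow v x y k).stage = s.stage := rfl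
      rw [e3, e4, e5]
      omega
    | second v x k h1 h2 h3 h4 h5 h6 h7 h8 h9 =>
      have e2 : {v | s.lcpOdd v ≠ none}.ncard <
          {w | (s.setLcpOdd x (k + 1)).lcpOdd w ≠ none}.ncard := by
        refine ncard_lt_of_imp (fun w hw => ?_) (a := x) ?_ (by simp [h9])
        · simp only [State.setLcpOdd]
          split_ifs
          · simp
          · exact hw
        · simp [State.setLcpOdd]
      have e1 : (s.setLcpOdd x (k + 1)).InS = s.InS := rfl
      have e3 : (s.setLcpOdd x (k + 1)).base = s.base := rfl
      have e4 : (s.setLcpOdd x (k + 1)).phase = s.phase := rfl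
      have e5 : (s.setLcpOdd x (k + 1)).stage = s.stage := rfl
      rw [e1, e3, e4, e5]
      omega
  | endGrowth h1 h2 =>
    rw [h1]
    change _ < 3 * s.phase + 1 + {v | s.InS v}.ncard + _ + _
    simp only [Stage.rank]
    omega
  | bridge _ x y hb =>
    cases hb with
    | blossom b kx ky h1 h2 h3 h4 h5 h6 =>
      obtain ⟨-, -, hx, hy, hne, -⟩ := h2
      have hbb := (h.anc_base_rep h6.1 (TreeInv.inS_of_even hx)).2
      have e1 : {v | s.InS v}.ncard ≤
          {w | (s.shrink x y b kx ky).InS w}.ncard := by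
        refine ncard_le_of_imp fun w hw => ?_
        simp only [State.InS, State.shrink]
        split_ifs
        · simp
        · exact hw
      have e3 : {v | s.base v ≠ v}.ncard <
          {w | (s.shrink x y b kx ky).base w ≠ w}.ncard := by
        have hmono : ∀ w, s.base w ≠ w → (s.shrink x y b kx ky).base w ≠ w := by
          intro w hw
          simp only [State.shrink]
          split_ifs
          · rintro rfl
            exact hw hbb
          · exact hw
        -- The nodes of `x` and `y` differ, so at least one of their representatives is not `b` and
        -- stops being a representative.
        by_cases hxb : s.base x = b
        · refine ncard_lt_of_imp hmono (a := s.base y) ?_ (by simp [h.base_base])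
          have : TreeInv.Shrunk s x y b (s.base y) :=
            Or.inr ⟨by rw [h.base_base]; exact .refl, by rw [h.base_base]; exact h6.2.1⟩
          rw [show (s.shrink x y b kx ky).base (s.base y) = b from if_pos this, ← hxb]
          exact hne
        · refine ncard_lt_of_imp hmono (a := s.base x) ?_ (by simp [h.base_base])
          have : TreeInv.Shrunk s x y b (s.base x) :=
            Or.inl ⟨by rw [h.base_base]; exact .refl, by rw [h.base_base]; exact h6.1⟩
          rw [show (s.shrink x y b kx ky).base (s.base x) = b from if_pos this]
          exact Ne.symm hxb
      have e2 : (s.shrink x y b kx ky).lcpOdd = s.lcpOdd := rfl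
      have e4 : (s.shrink x y b kx ky).phase = s.phase := rfl
      have e5 : (s.shrink x y b kx ky).stage = s.stage := rfl
      rw [e2, e4, e5]
      omega
    | augment h1 h2 h3 =>
      rw [h1]
      change _ < 3 * s.phase + 2 + {v | s.InS v}.ncard + _ + _
      simp only [Stage.rank]
      omega
  -- The rank may drop from 1 to 0 here; the factor 3 in front of the phase outweighs this.
  | nextPhase h1 h2 =>
    rw [h1.1]
    change _ < 3 * (s.phase + 1) + _ + {v | s.InS v}.ncard + _ + _
    simp only [Stage.rank]
    omega
  | giveUp h1 h2 =>
    rw [h1.1]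
    change _ < 3 * s.phase + 2 + {v | s.InS v}.ncard + _ + _
    simp only [Stage.rank]
    omega

lemma phase_bounds (h : Reachable M s) : s.phase ≤ Fintype.card V + 1 ∧
    (s.stage = Stage.exhausted → Fintype.card V + 1 ≤ s.phase) := by
  induction h with
  | refl => exact ⟨Nat.zero_le _, fun h => by cases h⟩
  | tail _ hst ih =>
    cases hst with
    | growth _ hg => cases hg <;> exact ih
    | endGrowth h1 h2 => exact ⟨ih.1, fun h => by cases h⟩
    | bridge _ x y hb =>
      cases hb with
      | blossom b kx ky h1 h2 h3 h4 h5 h6 => exact ih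
      | augment h1 h2 h3 => exact ⟨ih.1, fun h => by cases h⟩
    | nextPhase h1 h2 =>
      refine ⟨h2, fun h => ?_⟩
      simp only at h
      split_ifs at h
    | giveUp h1 h2 => exact ⟨ih.1, fun _ => by simp only; omega⟩

/-- The phase contributes at most `3 * (n + 1)`, the stage 2, and each of the three sets at most
`n`. -/
lemma progress_le (h : Reachable M s) : s.progress ≤ 6 * Fintype.card V + 5 := by
  have h1 := (phase_bounds h).1
  have h2 := s.stage.rank_le
  unfold State.progress
  simp only [← Nat.card_eq_fintype_card] at h1 ⊢
  have := Set.ncard_le_card {v | s.InS v}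
  have := Set.ncard_le_card {v | s.lcpOdd v ≠ none}
  have := Set.ncard_le_card {v | s.base v ≠ v}
  omega

lemma not_exists_infinite_run (hM : M.IsMatching) :
    ¬ ∃ run : ℕ → State V, run 0 = State.init M ∧ ∀ i, Step M (run i) (run (i + 1)) := by
  rintro ⟨run, h0, hrun⟩
  have hr : ∀ i, Reachable M (run i) := by
    intro i
    induction i with
    | zero => rw [h0]; exact .refl
    | succ i ih => exact ih.tail (hrun i)
  have hp : ∀ i, i ≤ (run i).progress := by
    intro i
    induction i with
    | zero => exact Nat.zero_le _
    | succ i ih =>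
      have := (Inv.of_reachable hM (hr i)).progress_lt (hrun i)
      omega
  have h1 := hp (6 * Fintype.card V + 6)
  have h2 := progress_le (hr (6 * Fintype.card V + 6))
  omega

end Termination

/-! ### Correctness -/

lemma IsAugmentingPath.odd_length {f g : V} {p : G.Walk f g} (h : IsAugmentingPath M p) :
    Odd p.length := by
  rw [← Nat.not_even_iff_odd]
  intro he
  have hp := h.1.aPath h.2.1
  by_cases h0 : p.length = 0
  · exact h.2.2.2 (SimpleGraph.Walk.eq_of_length_eq_zero h0)
  · exact hp.not_isFree he h0 h.2.2.1

namespace Inv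

lemma le_length_of_augmenting (h : Inv M s) {f g : V} {p : G.Walk f g}
    (hp : IsAugmentingPath M p) : 2 * s.phase ≤ p.length + 1 := by
  obtain ⟨y, z, hd, hy, -⟩ := h.dual
  have := hd.le_of_augmenting (h.dual_free hy) (hp.1.aPath hp.2.1) hp.odd_length hp.2.2.1
  omega

/-- The path found by the algorithm. -/
lemma exists_augmenting (h : Inv M s) {x y : V} (hbr : s.IsBridge M x y)
    (hT : ¬ s.SameTree x y) : ∃ (f g : V) (p : G.Walk f g),
      p.support = s.canon x ++ (s.canon y).reverse ∧ IsAugmentingPath M p ∧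
      p.length + 1 = 2 * s.phase := by
  obtain ⟨hadj, hxy, hx, hy, -, kx, ky, ex, ey, hsum⟩ := hbr
  obtain ⟨kx', ex', hkx, hpx⟩ := h.even x hx
  obtain rfl : kx = kx' := by rw [ex] at ex'; simpa using ex'
  obtain ⟨ky', ey', hky, hpy⟩ := h.even y hy
  obtain rfl : ky = ky' := by rw [ey] at ey'; simpa using ey'
  have hdis : ∀ w ∈ s.canon x, w ∉ (s.canon y).reverse := by
    intro w hw hw'
    rw [List.mem_reverse] at hw'
    -- A common vertex would lie in a common ancestor node, although the trees are different.
    exact hT ⟨_, h.anc_of_mem_canon (TreeInv.inS_of_even hx) hw,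
      h.anc_of_mem_canon (TreeInv.inS_of_even hy) hw'⟩
  have halt := hpy.alt.reverse
  rw [hpy.len, bodd_eq_true_iff.2 hky.add_one] at halt
  obtain ⟨g, l, hg, hgf, hl⟩ := hpy.exists_cons
  obtain ⟨r, hr, hrl⟩ := hpy.exists_eq_append
  have hrev : (s.canon y).reverse = y :: r.reverse := by rw [hr]; simp
  have hlast : (s.canon y).reverse.getLast? = some g := by rw [hg]; simp
  have hnd : (s.canon y).reverse.Nodup := List.nodup_reverse.2 hpy.nodup
  rw [hrev] at hdis halt hlast hnd ⊢
  have hp := hpx.join hkx (by simpa using halt) hnd hadj hxy hdis hlast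
  obtain ⟨f, p, hps, hf, hpa, hpl⟩ := hp.exists_walk
  rw [List.length_reverse] at hpl
  refine ⟨f, g, p, hps, ⟨hpa, hf, hgf, ?_⟩, by omega⟩
  rintro rfl
  have : p.length = 0 :=
    SimpleGraph.Walk.length_eq_zero_iff.2 (SimpleGraph.Walk.isPath_iff_nil.1 hpa.1)
  omega

lemma exists_lcp_of_aPath (h : Inv M s) {l : List V} {k : ℕ} {u : V} (hp : APath M l k u)
    (hk : Even k) (hlt : k < s.phase) : ∃ i, s.lcp u = some i ∧ i ≤ k := by
  have hle := hp.lcp_le hk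
  have hu : s.label u = Label.even := by
    by_contra hu
    have : s.phase ≤ k := by exact_mod_cast (h.phase_le_lcp hu).trans hle
    omega
  obtain ⟨i, hi, -⟩ := h.even u hu
  refine ⟨i, hi, ?_⟩
  rw [h.lcp_eq hi] at hle
  exact_mod_cast hle

/-- After the growth steps of an even phase `Δ`, the vertices reached by alternating paths of
length at most `Δ` belong to the search structure. -/
lemma inS_of_aPath (h : Inv M s) (he : Even s.phase) (hst : s.stage ≠ Stage.growing)
    {l : List V} {k : ℕ} {v : V} (hp : APath M l k v) (hk : k ≤ s.phase) : s.InS v := by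
  have hodd : ∀ {l k v}, APath M l k v → Odd k → k ≤ s.phase → s.InS v := by
    intro l k v hp ho hk
    obtain ⟨j, rfl⟩ := ho
    obtain ⟨l', u, -, hu, huv, -, -⟩ := hp.pred
    obtain ⟨i, hi, hij⟩ := h.exists_lcp_of_aPath hu (even_two_mul j) (by omega)
    -- Both `i ≤ 2 * j < Δ` and the evenness of `Δ` are needed to conclude `i + 2 ≤ Δ`.
    obtain ⟨c, hc⟩ := he
    exact (h.complete u v i hi huv (Or.inr ⟨by omega, hst⟩)).1
  rcases Nat.even_or_odd k with hke | hko
  swap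
  · exact hodd hp hko hk
  cases k with
  | zero =>
    obtain ⟨l', rfl, hl⟩ := hp.exists_eq_append
    obtain rfl := List.length_eq_zero_iff.1 hl
    exact TreeInv.inS_of_even (h.free v (hp.free v (by simp))).1
  | succ k =>
    obtain ⟨l', u, -, hu, -, hM, -⟩ := hp.pred
    have hko : Odd k := by
      rw [Nat.even_add_one, Nat.not_even_iff_odd] at hke; exact hke
    have hS := hodd hu hko (by omega)
    exact fun hv => hS (h.mate_unlabeled v u (hM.2 hko).symm hv)

/-! ### Completed phases, and the absence of deadlocks. -/

section Completed

variable [Fintype V]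

/-- The dual solution already adjusted for phase `Δ + 1` gives `Lcp M v ≥ Δ + 1` for every vertex
that is not even. -/
lemma exists_lcp_of_completed (h : Inv M s) (hM : M.IsMatching) (hc : PhaseCompleted M s) {v : V}
    (hv : Lcp M v ≤ s.phase) : ∃ k, s.lcp v = some k := by
  obtain ⟨y, z, hd, hy, -⟩ := h.exists_dual_succ hM hc
  have hT := h.toTreeInv.of_phase_le (Nat.le_succ s.phase) s.stage
  have hl : s.label v = Label.even := by
    by_contra hl
    have := (hT.phase_le_lcp hd hy hl).trans hv
    have : s.phase + 1 ≤ s.phase := by exact_mod_cast this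
    omega
  obtain ⟨k, hk, -⟩ := h.even v hl
  exact ⟨k, hk⟩

/-- The last but one vertex `u` of a shortest odd path has a defined `lcp` below `LcpOdd M v`. Were
the odd value undefined, `complete` would give `Lcp M v ≤ Lcp M u`, contradicting `LcpOdd M v < Lcp
M v`. -/
lemma exists_lcpOdd_of_completed (h : Inv M s) (hM : M.IsMatching) (hc : PhaseCompleted M s)
    {v : V} (hlt : LcpOdd M v < Lcp M v) (hv : Lcp M v ≤ s.phase) :
    ∃ k, s.lcpOdd v = some k := by
  obtain ⟨l, hl⟩ := h.exists_lcp_of_completed hM hc hv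
  by_contra hn
  have hn : s.lcpOdd v = none := by
    cases ho : s.lcpOdd v with
    | none => rfl
    | some k => exact absurd ⟨k, ho⟩ hn
  obtain ⟨p, k, hp, hk, e⟩ := exists_aPath_of_lcpOdd_ne_top hlt.ne_top
  rw [h.lcp_eq hl] at hv hlt
  rw [e] at hlt
  have hkl : k < l := by exact_mod_cast hlt
  have hls : l ≤ s.phase := by exact_mod_cast hv
  obtain ⟨j, rfl⟩ := hk
  obtain ⟨p', u, -, hu, huv, hMuv, -⟩ := hp.pred
  obtain ⟨i, hi, hij⟩ := h.exists_lcp_of_aPath hu (even_two_mul j) (by omega)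
  have := (h.complete u v i hi huv (Or.inr ⟨by omega, by rw [hc.1]; simp⟩)).2 l hl hn
    (by rw [hMuv, Nat.not_odd_iff_even]; exact even_two_mul j)
  omega

/-- The dual solution adjusted for phase `Δ + 1` gives `y u + y v ≤ Lcp u + Lcp v - 2 * Δ = -2`. If
the nodes were different, `z u v` would vanish and the edge would violate dual feasibility. -/
lemma same_blossom_of_completed (h : Inv M s) (hM : M.IsMatching) (hc : PhaseCompleted M s)
    {u v : V} (huv : G.Adj u v) (hsum : Lcp M u + Lcp M v + 2 = ((2 * s.phase : ℕ) : ℕ∞)) :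
    s.label u = Label.even ∧ s.label v = Label.even ∧ s.base u = s.base v := by
  obtain ⟨y, z, hd, hy, hz⟩ := h.exists_dual_succ hM hc
  have hT := h.toTreeInv.of_phase_le (Nat.le_succ s.phase) s.stage
  have hbase : s.base u = s.base v := by
    by_contra hb
    have hu : Lcp M u ≠ ⊤ := by
      intro e; rw [e] at hsum; simp at hsum; exact ENat.natCast_ne_top _ (by exact_mod_cast hsum.symm)
    have hv : Lcp M v ≠ ⊤ := by
      intro e; rw [e] at hsum; simp at hsum; exact ENat.natCast_ne_top _ (by exact_mod_cast hsum.symm)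
    obtain ⟨_, a, hpa, hae, ea⟩ := exists_aPath_of_lcp_ne_top hu
    obtain ⟨_, b, hpb, hbe, eb⟩ := exists_aPath_of_lcp_ne_top hv
    rw [ea, eb] at hsum
    have hsum' : a + b + 2 = 2 * s.phase := by exact_mod_cast hsum
    have h1 := hd.le_of_aPath (hT.dual_free hy) hpa hae
    have h2 := hd.le_of_aPath (hT.dual_free hy) hpb hbe
    have h3 := hz u v hb
    have h4 : 0 ≤ y u + y v + z u v := by
      by_cases hMuv : M.Adj u v
      · rw [hd.tight u v hMuv]; norm_num
      · exact hd.nonneg u v huv hMuv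
    push_cast at h1 h2
    omega
  refine ⟨?_, ?_, hbase⟩
  · by_cases hb : s.base u = u
    · have := h.base_mate v (by rw [← hbase, hb]; exact huv.ne)
      rw [← hbase, hb] at this
      exact this.2.1
    · exact (h.base_mate u hb).1
  · by_cases hb : s.base v = v
    · have := h.base_mate u (by rw [hbase, hb]; exact huv.ne.symm)
      rw [hbase, hb] at this
      exact this.2.1
    · exact (h.base_mate v hb).1

/-- Any other stage allows a further step. In particular, a bridge within one tree can always be
processed, because lowest common ancestors exist. -/
lemma found_or_exhausted (h : Inv M s) (ht : Terminated M s) :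
    (∃ x y, s.stage = Stage.found x y) ∨ s.stage = Stage.exhausted := by
  classical
  cases hst : s.stage with
  | growing =>
    exfalso
    by_cases hg : ∃ t, GrowthStep M s t
    · obtain ⟨t, hg⟩ := hg
      exact ht _ (Step.growth _ _ hg)
    · push Not at hg
      exact ht _ (Step.endGrowth _ hst hg)
  | bridging =>
    exfalso
    by_cases hb : ∃ x y, s.IsBridge M x y
    · obtain ⟨x, y, hb⟩ := hb
      by_cases hT : s.SameTree x y
      · obtain ⟨b, hlca⟩ := h.exists_isLCA (TreeInv.inS_of_even hb.2.2.1) hT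
        obtain ⟨-, -, -, -, -, kx, ky, ex, ey, -⟩ := id hb
        exact ht _ (Step.bridge _ _ x y (BridgeStep.blossom s x y b kx ky hst hb ex ey hT hlca))
      · exact ht _ (Step.bridge _ _ x y (BridgeStep.augment s x y hst hb hT))
    · push Not at hb
      by_cases hp : s.phase + 1 ≤ Fintype.card V + 1
      · exact ht _ (Step.nextPhase s ⟨hst, hb⟩ hp)
      · exact ht _ (Step.giveUp s ⟨hst, hb⟩ hp)
  | found x y => exact Or.inl ⟨x, y, rfl⟩
  | exhausted => exact Or.inr rfl

end Completed

end Inv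

lemma BridgeStep.isBridge {t : State V} {x y : V} (h : BridgeStep M s x y t) :
    s.IsBridge M x y := by
  cases h with
  | blossom _ _ _ _ h => exact h
  | augment _ h => exact h

end ShortestAugmentingPath

open ShortestAugmentingPath in
theorem mainTheorem1 {V : Type*} [Fintype V] (G : SimpleGraph V) (M : G.Subgraph)
    (hM : M.IsMatching) :
    -- end of an even phase: the vertices of `S`
    (∀ s, Reachable M s → Even s.phase →
      (PhaseCompleted M s ∨ ∃ x y, s.stage = Stage.found x y) →
      ∀ v, s.InS v ↔ ∃ (f : V) (p : G.Walk f v), IsFree M f ∧ IsAlternatingPath M p ∧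
        p.length ≤ s.phase) ∧
    -- end of a completed even phase: values that are defined
    (∀ s, Reachable M s → Even s.phase → PhaseCompleted M s → ∀ v,
      (Lcp M v ≤ (s.phase : ℕ∞) → ∃ k, s.lcp v = some k) ∧
      (LcpOdd M v < Lcp M v → Lcp M v ≤ (s.phase : ℕ∞) → ∃ k, s.lcpOdd v = some k)) ∧
    -- every edge added in a bridge step
    (∀ s t x y, Reachable M s → BridgeStep M s x y t →
      Lcp M x + Lcp M y + 2 = ((2 * s.phase : ℕ) : ℕ∞) ∧
      (∃ k : ℕ, s.lcp x = some k ∧ Lcp M x = (k : ℕ∞)) ∧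
      (∃ k : ℕ, s.lcp y = some k ∧ Lcp M y = (k : ℕ∞))) ∧
    -- all edges with the right sum are taken care of in a completed phase
    (∀ s, Reachable M s → PhaseCompleted M s → ∀ u v, G.Adj u v →
      Lcp M u + Lcp M v + 2 = ((2 * s.phase : ℕ) : ℕ∞) →
      s.label u = Label.even ∧ s.label v = Label.even ∧ s.base u = s.base v) ∧
    -- at any point in the execution, the defined values are correct
    (∀ s, Reachable M s → ∀ (v : V) (k : ℕ),
      (s.lcp v = some k → Lcp M v = (k : ℕ∞)) ∧
      (s.lcpOdd v = some k → LcpOdd M v = (k : ℕ∞))) ∧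
    -- the canonical path of an even vertex is a shortest even-length alternating path
    (∀ s, Reachable M s → ∀ v, s.label v = Label.even →
      ∃ (f : V) (p : G.Walk f v), p.support = s.canon v ∧ IsFree M f ∧
        IsAlternatingPath M p ∧ Even p.length ∧ (p.length : ℕ∞) = Lcp M v) ∧
    -- every execution is finite
    (¬ ∃ run : ℕ → State V, run 0 = State.init M ∧ ∀ i, Step M (run i) (run (i + 1))) ∧
    -- on termination, a shortest augmenting path has been found, if there is an augmenting path
    (∀ s, Reachable M s → Terminated M s →
      (∃ x y, s.stage = Stage.found x y ∧
        ∃ (f g : V) (p : G.Walk f g), p.support = s.canon x ++ (s.canon y).reverse ∧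
          IsAugmentingPath M p ∧ p.length + 1 = 2 * s.phase ∧
          ∀ (f' g' : V) (q : G.Walk f' g'), IsAugmentingPath M q → p.length ≤ q.length) ∨
      (s.stage = Stage.exhausted ∧
        ¬ ∃ (f g : V) (p : G.Walk f g), IsAugmentingPath M p)) := by
  refine ⟨?_, ?_, ?_, ?_, ?_, ?_, not_exists_infinite_run hM, ?_⟩
  · intro s hs he hend v
    have h := Inv.of_reachable hM hs
    constructor
    · intro hv
      obtain ⟨l, k, hp, hk⟩ := h.reach v hv
      obtain ⟨f, p, -, hf, hpa, rfl⟩ := hp.exists_walk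
      exact ⟨f, p, hf, hpa, hk⟩
    · rintro ⟨f, p, hf, hpa, hk⟩
      refine h.inS_of_aPath he ?_ (hpa.aPath hf) hk
      rcases hend with hc | ⟨x, y, hxy⟩
      · rw [hc.1]; simp
      · rw [hxy]; simp
  · intro s hs _ hc v
    have h := Inv.of_reachable hM hs
    exact ⟨h.exists_lcp_of_completed hM hc, h.exists_lcpOdd_of_completed hM hc⟩
  · intro s t x y hs hb
    have h := Inv.of_reachable hM hs
    obtain ⟨-, -, -, -, -, kx, ky, ex, ey, hsum⟩ := hb.isBridge
    refine ⟨?_, ⟨kx, ex, h.lcp_eq ex⟩, ky, ey, h.lcp_eq ey⟩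
    rw [h.lcp_eq ex, h.lcp_eq ey, ← hsum]
    push_cast
    rfl
  · intro s hs hc u v huv hsum
    exact (Inv.of_reachable hM hs).same_blossom_of_completed hM hc huv hsum
  · intro s hs v k
    have h := Inv.of_reachable hM hs
    exact ⟨h.lcp_eq, h.lcpOdd_eq v k⟩
  · intro s hs v hv
    have h := Inv.of_reachable hM hs
    obtain ⟨k, hk, hke, hp⟩ := h.even v hv
    obtain ⟨f, p, hps, hf, hpa, rfl⟩ := hp.exists_walk
    exact ⟨f, p, hps, hf, hpa, hke, (h.lcp_eq hk).symm⟩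
  · intro s hs ht
    have h := Inv.of_reachable hM hs
    rcases h.found_or_exhausted ht with ⟨x, y, hxy⟩ | hex
    · left
      obtain ⟨hb, hT⟩ := h.found x y hxy
      obtain ⟨f, g, p, hps, hp, hl⟩ := h.exists_augmenting hb hT
      refine ⟨x, y, hxy, f, g, p, hps, hp, hl, fun f' g' q hq => ?_⟩
      have := h.le_length_of_augmenting hq
      omega
    · right
      refine ⟨hex, ?_⟩
      rintro ⟨f, g, p, hp⟩
      -- In phase `n + 1` an augmenting path would need at least `2 * n + 1` edges, while a simple
      -- path has fewer than `n`.
      have h1 := h.le_length_of_augmenting hp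
      have h2 := (phase_bounds hs).2 hex
      have h3 := hp.1.1.length_lt
      omega
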